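/- Let $p,n\ge 1$, let $\mathcal{H}_p$ be the space of $p\times p$ complex Hermitian matrices, $\mathcal{SH}_p^{++}$ the manifold of $p\times p$ Hermitian positive definite matrices of determinant $1$, with tangent spaces $T_{\Sigma}\mathcal{SH}_p^{++}=\{\xi_\Sigma\in\mathcal{H}_p:\operatorname{tr}(\Sigma^{-1}\xi_\Sigma)=0\}$, and $\mathbb{R}_{++}^n$ the manifold of vectors in $\mathbb{R}^n$ with positive entries, with tangent spaces $\mathbb{R}^n$. Equip $\mathcal{SH}_p^{++}$ with the metric $\operatorname{tr}(\Sigma^{-1}\xi_\Sigma\Sigma^{-1}\eta_\Sigma)$, equip $\mathbb{R}_{++}^n$ with the metric $\sum_i \tau_i^{-2}\,\xi_{\tau,i}\,\eta_{\tau,i}$, and equip $\mathcal{M}_{p,n}=\mathcal{SH}_p^{++}\times\mathbb{R}_{++}^n$ with the Fisher metric of the compound Gaussian distribution (normalized up to a factor): for $\theta=(\Sigma,\tau)$ and tangent vectors $\xi=(\xi_\Sigma,\xi_\tau)$, $\eta=(\eta_\Sigma,\eta_\tau)$, $$\langle\xi,\eta\rangle_\theta=\frac1p\operatorname{tr}(\Sigma^{-1}\xi_\Sigma\Sigma^{-1}\eta_\Sigma)+\frac1n\sum_{i=1}^n\frac{\xi_{\tau,i}\,\eta_{\tau,i}}{\tau_i^2}.$$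 Products, inverses, powers, exponentials and logarithms of vectors of $\mathbb{R}^n$ are taken elementwise, and $\odot$ is the elementwise product. "Interval" means an interval of $\mathbb{R}$ with more than one point. Then: (i) A curve $\gamma=(\gamma^{\mathcal{SH}},\gamma^{\mathbb{R}})$ on an interval is a geodesic of $\mathcal{M}_{p,n}$ if and only if $\gamma^{\mathcal{SH}}$ is a geodesic of $\mathcal{SH}_p^{++}$ and $\gamma^{\mathbb{R}}$ is a geodesic of $\mathbb{R}_{++}^n$. (ii) For $\theta=(\Sigma,\tau)\in\mathcal{M}_{p,n}$ and $\xi=(\xi_\Sigma,\xi_\tau)\in T_\theta\mathcal{M}_{p,n}$, the curve $$\gamma(t)=\big(\Sigma\exp(t\Sigma^{-1}\xi_\Sigma),\ \tau\odot\exp(t\,\tau^{-1}\odot\xi_\tau)\big),\qquad t\in\mathbb{R},$$ is a geodesic of $\mathcal{M}_{p,n}$ with $\gamma(0)=\theta$ and $\dot\gamma(0)=\xi$, and every geodesic on an interval containing $0$ with this initial point and velocity coincides with it there. (iii) For $\theta_0=(\Sigma_0,\tau_0)$ and $\theta_1=(\Sigma_1,\tau_1)$ in $\mathcal{M}_{p,n}$,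 the curve $$\gamma(t)=\big(\Sigma_0^{1/2}(\Sigma_0^{-1/2}\Sigma_1\Sigma_0^{-1/2})^t\,\Sigma_0^{1/2},\ \tau_0^{1-t}\odot\tau_1^{t}\big),\qquad t\in\mathbb{R},$$ is a geodesic of $\mathcal{M}_{p,n}$ with $\gamma(0)=\theta_0$ and $\gamma(1)=\theta_1$, and every geodesic on an interval containing $0$ and $1$ with these values at $0$ and $1$ coincides with it there. (iv) Any two points $\theta_0,\theta_1$ of $\mathcal{M}_{p,n}$ are joined by a $C^1$ curve in $\mathcal{M}_{p,n}$, and the Riemannian distance $\delta$ (the infimum of the lengths of such curves) satisfies $$\delta^2(\theta_0,\theta_1)=\frac1p\big\|\log(\Sigma_0^{-1/2}\Sigma_1\Sigma_0^{-1/2})\big\|_F^2+\frac1n\big\|\log(\tau_0^{-1}\odot\tau_1)\big\|_2^2,$$ with the Frobenius norm of matrices and the Euclidean norm of vectors. -/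

import Mathlib

open Set
open scoped Matrix Matrix.Norms.Frobenius ComplexOrder ContDiff

noncomputable section

namespace CompoundGaussian

section Riemannian

variable {E : Type*} [NormedAddCommGroup E] [NormedSpace ℝ E]

/-- The Christoffel symbols of the Levi-Civita connection of a metric `g` on (an open part of) a
vector space, lowered with `g`: by the Koszul formula for constant vector fields,
`g x (Γ x (u, v)) w = 1/2 (D_u g(v, w) + D_v g(u, w) - D_w g(u, v))` at `x`. -/
def christoffel (g : E → E → E → ℝ) (x u v w : E) : ℝ :=
  (1 / 2) * (lineDeriv ℝ (fun y => g y v w) x u + lineDeriv ℝ (fun y => g y u w) x v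
    - lineDeriv ℝ (fun y => g y u v) x w)

/-- The `g`-inner product with `w` of the covariant acceleration
`γ'' + Γ (γ', γ')` of the curve `γ`, defined on the interval `J`, at time `t`. -/
def accelInner (g : E → E → E → ℝ) (γ : ℝ → E) (J : Set ℝ) (t : ℝ) (w : E) : ℝ :=
  g (γ t) (derivWithin (derivWithin γ J) J t) w
    + christoffel g (γ t) (derivWithin γ J t) (derivWithin γ J t) w

/-- `γ` restricted to the interval `J` is a geodesic of the embedded submanifold `S` with tangent
spaces `T` and metric `g`: it is a smooth curve in `S` whose acceleration for the Levi-Civita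
connection of `S` vanishes. The Levi-Civita connection of `S` is the tangential part of the
ambient one, so this says that the ambient covariant acceleration is `g`-orthogonal
to `T (γ t)`. -/
def IsGeodesicOn (S : Set E) (T : E → Set E) (g : E → E → E → ℝ) (γ : ℝ → E) (J : Set ℝ) : Prop :=
  ContDiffOn ℝ ∞ γ J ∧ MapsTo γ J S ∧ ∀ t ∈ J, ∀ w ∈ T (γ t), accelInner g γ J t w = 0

/-- The length of the curve `γ` on `[0, 1]` for the metric `g`. -/
def curveLength (g : E → E → E → ℝ) (γ : ℝ → E) : ℝ :=
  ∫ t in (0 : ℝ)..1,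
    √(g (γ t) (derivWithin γ (Icc 0 1) t) (derivWithin γ (Icc 0 1) t))

/-- The lengths of the `C^1` curves in `S` from `x` to `y`. -/
def curveLengths (S : Set E) (g : E → E → E → ℝ) (x y : E) : Set ℝ :=
  {L | ∃ γ : ℝ → E, ContDiffOn ℝ 1 γ (Icc 0 1) ∧ MapsTo γ (Icc 0 1) S ∧ γ 0 = x ∧ γ 1 = y ∧
    curveLength g γ = L}

/-- The Riemannian distance on the connected submanifold `S` with metric `g`. -/
def riemannianDist (S : Set E) (g : E → E → E → ℝ) (x y : E) : ℝ :=
  sInf (curveLengths S g x y)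

end Riemannian

variable {p n : ℕ}

/-- Hermitian positive definite matrices of determinant one. -/
def SHPD (p : ℕ) : Set (Matrix (Fin p) (Fin p) ℂ) :=
  {A | A.PosDef ∧ A.det = 1}

/-- The tangent space to `SHPD p` at `A`. -/
def tangentSHPD (A : Matrix (Fin p) (Fin p) ℂ) : Set (Matrix (Fin p) (Fin p) ℂ) :=
  {ξ | ξ.IsHermitian ∧ (A⁻¹ * ξ).trace = 0}

/-- The affine-invariant metric `tr (A⁻¹ ξ A⁻¹ η)` (a real number for Hermitian arguments). -/
def metricHPD (A ξ η : Matrix (Fin p) (Fin p) ℂ) : ℝ :=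
  (A⁻¹ * ξ * A⁻¹ * η).trace.re

/-- Vectors with positive entries. -/
def PosVec (n : ℕ) : Set (Fin n → ℝ) := {τ | ∀ i, 0 < τ i}

/-- The tangent space to `PosVec n`: all of `ℝ^n`. -/
def tangentPosVec (_τ : Fin n → ℝ) : Set (Fin n → ℝ) := univ

/-- The metric `(ξ ⊙ τ⁻¹)ᵀ (η ⊙ τ⁻¹)` on positive vectors. -/
def metricPosVec (τ ξ η : Fin n → ℝ) : ℝ := ∑ i, (ξ i * (τ i)⁻¹) * (η i * (τ i)⁻¹)

/-- The vector space containing the parameters `θ = (Σ, τ)`. -/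
abbrev Param (p n : ℕ) : Type := Matrix (Fin p) (Fin p) ℂ × (Fin n → ℝ)

/-- The parameter manifold. -/
def paramManifold (p n : ℕ) : Set (Param p n) := SHPD p ×ˢ PosVec n

/-- The tangent space to the parameter manifold at `θ`. -/
def tangentParam (θ : Param p n) : Set (Param p n) := tangentSHPD θ.1 ×ˢ tangentPosVec θ.2

/-- The Fisher information metric of the compound Gaussian distribution
(normalized up to a factor). -/
def fisherMetric (θ ξ η : Param p n) : ℝ :=
  (1 / (p : ℝ)) * metricHPD θ.1 ξ.1 η.1 + (1 / (n : ℝ)) * metricPosVec θ.2 ξ.2 η.2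

/-- Real power of a Hermitian positive definite matrix (functional calculus). -/
def hpow (A : Matrix (Fin p) (Fin p) ℂ) (s : ℝ) : Matrix (Fin p) (Fin p) ℂ :=
  cfc (fun x : ℝ => x ^ s) A

/-- Logarithm of a Hermitian positive definite matrix (functional calculus). -/
def hlog (A : Matrix (Fin p) (Fin p) ℂ) : Matrix (Fin p) (Fin p) ℂ := cfc Real.log A

/-- `Σ₀^(-1/2) Σ₁ Σ₀^(-1/2)`. -/
def whiten (A B : Matrix (Fin p) (Fin p) ℂ) : Matrix (Fin p) (Fin p) ℂ :=
  hpow A (-(1 / 2)) * B * hpow A (-(1 / 2))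

/-- `t ↦ (Σ exp (t Σ⁻¹ ξ_Σ), τ ⊙ exp (t τ⁻¹ ⊙ ξ_τ))`. -/
def expCurve (θ ξ : Param p n) (t : ℝ) : Param p n :=
  (θ.1 * NormedSpace.exp (t • (θ.1⁻¹ * ξ.1)),
    fun i => θ.2 i * Real.exp (t * ((θ.2 i)⁻¹ * ξ.2 i)))

/-- `t ↦ (Σ₀^(1/2) (Σ₀^(-1/2) Σ₁ Σ₀^(-1/2))^t Σ₀^(1/2), τ₀^(1-t) ⊙ τ₁^t)`. -/
def joinCurve (θ₀ θ₁ : Param p n) (t : ℝ) : Param p n :=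
  (hpow θ₀.1 (1 / 2) * hpow (whiten θ₀.1 θ₁.1) t * hpow θ₀.1 (1 / 2),
    fun i => θ₀.2 i ^ (1 - t) * θ₁.2 i ^ t)

end CompoundGaussian

end

open CompoundGaussian

/-!
On the units of a Banach algebra with a trace `φ`, the metric `φ (x⁻¹ v x⁻¹ w)` has geodesic
equation `γ'' = γ' γ⁻¹ γ'`, that is, `γ⁻¹ γ'` is constant; so the geodesics are `x exp (t x⁻¹ v)`.
Both factors are of this kind, with the real part of the matrix trace and with the sum of
coordinates. On the determinant-one matrices `γ'' - γ' γ⁻¹ γ'` is automatically tangent, since its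
trace against `γ⁻¹` is the derivative of `tr (γ⁻¹ γ') = (log det γ)' = 0`. A weighted product metric
splits the geodesic equation, by testing it against tangent vectors of one factor at a time.

For the distance, whitening by `γ 0` is an isometry, so let `γ 0 = 1`. The derivative of
`‖log γ‖²` is `2 tr (log γ · γ⁻¹ γ')`, at most `2 ‖log γ‖` times the speed, hence
`‖log (γ 1)‖` is at most the length of `γ`; on vectors the entrywise logarithm is an isometry.
Minkowski's inequality `√((∫ f)² + (∫ g)²) ≤ ∫ √(f² + g²)` combines the two factors, and the
geodesic of constant speed attains the bound.
-/

noncomputable section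

namespace CompoundGaussian

open Filter Topology
open scoped Ring

section Geodesics

variable {E F : Type*} [NormedAddCommGroup E] [NormedSpace ℝ E] [NormedAddCommGroup F]
  [NormedSpace ℝ F] {g g' : E → E → E → ℝ} {h : F → F → F → ℝ} {J : Set ℝ}

theorem uniqueDiffOn_of_ordConnected (hJ : J.OrdConnected) (hJ' : J.Nontrivial) :
    UniqueDiffOn ℝ J := by
  obtain ⟨a, ha, b, hb, hab⟩ := hJ'.exists_lt
  refine uniqueDiffOn_convex hJ.convex ⟨(a + b) / 2, interior_mono (hJ.out ha hb) ?_⟩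
  rw [interior_Icc]
  constructor <;> linarith

theorem eq_of_hasDerivWithinAt_zero {f : ℝ → E} (hJ : Convex ℝ J)
    (hf : ∀ t ∈ J, HasDerivWithinAt f 0 J t) {s t : ℝ} (hs : s ∈ J) (ht : t ∈ J) : f t = f s := by
  have hle := hJ.norm_image_sub_le_of_norm_hasDerivWithin_le (C := 0) hf (by simp) hs ht
  simpa [sub_eq_zero] using hle

theorem christoffel_congr {x : E} (hg : g =ᶠ[𝓝 x] g') (u v w : E) :
    christoffel g x u v w = christoffel g' x u v w := by
  have hline (v w u : E) : lineDeriv ℝ (fun y => g y v w) x u =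
      lineDeriv ℝ (fun y => g' y v w) x u :=
    EventuallyEq.lineDeriv_eq (hg.mono fun y hy => congrFun (congrFun hy v) w)
  simp only [christoffel, hline]

theorem isGeodesicOn_congr {S : Set E} {T : E → Set E} (hg : ∀ x ∈ S, g =ᶠ[𝓝 x] g') {γ : ℝ → E} :
    IsGeodesicOn S T g γ J ↔ IsGeodesicOn S T g' γ J := by
  refine and_congr_right fun _ => and_congr_right fun hS => forall₂_congr fun t ht => ?_
  simp only [accelInner, (hg _ (hS ht)).eq_of_nhds, christoffel_congr (hg _ (hS ht))]

theorem accelInner_zero_right (hg : ∀ x v, g x v 0 = 0) (γ : ℝ → E) (J : Set ℝ) (t : ℝ) :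
    accelInner g γ J t 0 = 0 := by
  simp [accelInner, christoffel, hg, lineDeriv]

theorem hasDerivWithinAt_fst {γ : ℝ → E × F} {v : E × F} {t : ℝ}
    (hγ : HasDerivWithinAt γ v J t) : HasDerivWithinAt (fun r => (γ r).1) v.1 J t := by
  simpa using hγ.hasFDerivWithinAt.fst.hasDerivWithinAt

theorem hasDerivWithinAt_snd {γ : ℝ → E × F} {v : E × F} {t : ℝ}
    (hγ : HasDerivWithinAt γ v J t) : HasDerivWithinAt (fun r => (γ r).2) v.2 J t := by
  simpa using hγ.hasFDerivWithinAt.snd.hasDerivWithinAt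

theorem derivWithin_fst {γ : ℝ → E × F} {t : ℝ} (hγ : DifferentiableWithinAt ℝ γ J t)
    (hJ : UniqueDiffWithinAt ℝ J t) :
    derivWithin (fun r => (γ r).1) J t = (derivWithin γ J t).1 :=
  (hasDerivWithinAt_fst hγ.hasDerivWithinAt).derivWithin hJ

theorem derivWithin_snd {γ : ℝ → E × F} {t : ℝ} (hγ : DifferentiableWithinAt ℝ γ J t)
    (hJ : UniqueDiffWithinAt ℝ J t) :
    derivWithin (fun r => (γ r).2) J t = (derivWithin γ J t).2 :=
  (hasDerivWithinAt_snd hγ.hasDerivWithinAt).derivWithin hJ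

/-- The metric `a g ⊕ b h` on a product, from metrics `g` and `h` on the factors. -/
def prodMetric (a : ℝ) (g : E → E → E → ℝ) (b : ℝ) (h : F → F → F → ℝ) (x v w : E × F) : ℝ :=
  a * g x.1 v.1 w.1 + b * h x.2 v.2 w.2

theorem christoffel_prodMetric {x : E × F}
    (hg : ∀ v w u, LineDifferentiableAt ℝ (fun y => g y v w) x.1 u)
    (hh : ∀ v w u, LineDifferentiableAt ℝ (fun y => h y v w) x.2 u) (a b : ℝ) (u v w : E × F) :
    christoffel (prodMetric a g b h) x u v w =
      a * christoffel g x.1 u.1 v.1 w.1 + b * christoffel h x.2 u.2 v.2 w.2 := by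
  have hline (v w u : E × F) : lineDeriv ℝ (fun y => prodMetric a g b h y v w) x u =
      a * lineDeriv ℝ (fun y => g y v.1 w.1) x.1 u.1 +
        b * lineDeriv ℝ (fun y => h y v.2 w.2) x.2 u.2 :=
    HasLineDerivAt.lineDeriv (HasDerivAt.add
      (HasDerivAt.const_mul a (hg v.1 w.1 u.1).hasLineDerivAt)
      (HasDerivAt.const_mul b (hh v.2 w.2 u.2).hasLineDerivAt))
  simp only [christoffel, hline]
  ring

theorem accelInner_prodMetric (hJ : UniqueDiffOn ℝ J) {γ : ℝ → E × F} (hγ : ContDiffOn ℝ 2 γ J)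
    {t : ℝ} (ht : t ∈ J)
    (hg : ∀ v w u, LineDifferentiableAt ℝ (fun y => g y v w) (γ t).1 u)
    (hh : ∀ v w u, LineDifferentiableAt ℝ (fun y => h y v w) (γ t).2 u) (a b : ℝ) (w : E × F) :
    accelInner (prodMetric a g b h) γ J t w =
      a * accelInner g (fun r => (γ r).1) J t w.1 +
        b * accelInner h (fun r => (γ r).2) J t w.2 := by
  have hd : DifferentiableOn ℝ γ J := hγ.differentiableOn (by simp)
  have hd' : DifferentiableOn ℝ (derivWithin γ J) J :=
    (hγ.derivWithin (m := 1) hJ (by norm_num)).differentiableOn (by simp)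
  have hfst : EqOn (derivWithin (fun r => (γ r).1) J) (fun r => (derivWithin γ J r).1) J :=
    fun r hr => derivWithin_fst (hd r hr) (hJ r hr)
  have hsnd : EqOn (derivWithin (fun r => (γ r).2) J) (fun r => (derivWithin γ J r).2) J :=
    fun r hr => derivWithin_snd (hd r hr) (hJ r hr)
  rw [accelInner, accelInner, accelInner, christoffel_prodMetric hg hh, prodMetric,
    derivWithin_congr hfst (hfst ht), derivWithin_congr hsnd (hsnd ht), hfst ht, hsnd ht,
    derivWithin_fst (hd' t ht) (hJ t ht), derivWithin_snd (hd' t ht) (hJ t ht)]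
  ring

theorem isGeodesicOn_prodMetric_iff {a b : ℝ} (ha : a ≠ 0) (hb : b ≠ 0) {S₁ : Set E} {S₂ : Set F}
    {T₁ : E → Set E} {T₂ : F → Set F}
    (hT₁ : ∀ x ∈ S₁, 0 ∈ T₁ x) (hT₂ : ∀ x ∈ S₂, 0 ∈ T₂ x)
    (hg₀ : ∀ x v, g x v 0 = 0) (hh₀ : ∀ x v, h x v 0 = 0)
    (hg : ∀ x ∈ S₁, ∀ v w u, LineDifferentiableAt ℝ (fun y => g y v w) x u)
    (hh : ∀ x ∈ S₂, ∀ v w u, LineDifferentiableAt ℝ (fun y => h y v w) x u)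
    (hJ : UniqueDiffOn ℝ J) {γ : ℝ → E × F} :
    IsGeodesicOn (S₁ ×ˢ S₂) (fun x => T₁ x.1 ×ˢ T₂ x.2) (prodMetric a g b h) γ J ↔
      IsGeodesicOn S₁ T₁ g (fun t => (γ t).1) J ∧ IsGeodesicOn S₂ T₂ h (fun t => (γ t).2) J := by
  have hprod (hγ : ContDiffOn ℝ ∞ γ J) (hS : MapsTo γ J (S₁ ×ˢ S₂)) {t : ℝ} (ht : t ∈ J) :=
    accelInner_prodMetric hJ (contDiffOn_infty.1 hγ 2) ht (hg _ (hS ht).1)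
      (hh _ (hS ht).2) a b
  constructor
  · rintro ⟨hγ, hS, hacc⟩
    refine ⟨⟨hγ.fst, fun t ht => (hS ht).1, fun t ht w hw => ?_⟩,
      ⟨hγ.snd, fun t ht => (hS ht).2, fun t ht w hw => ?_⟩⟩
    · have := hacc t ht (w, 0) ⟨hw, hT₂ _ (hS ht).2⟩
      simpa [hprod hγ hS ht, accelInner_zero_right hh₀, ha] using this
    · have := hacc t ht (0, w) ⟨hT₁ _ (hS ht).1, hw⟩
      simpa [hprod hγ hS ht, accelInner_zero_right hg₀, hb] using this
  · rintro ⟨⟨hγ₁, hS₁, hacc₁⟩, ⟨hγ₂, hS₂, hacc₂⟩⟩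
    have hγ : ContDiffOn ℝ ∞ γ J := hγ₁.prodMk hγ₂
    have hS : MapsTo γ J (S₁ ×ˢ S₂) := fun t ht => ⟨hS₁ ht, hS₂ ht⟩
    refine ⟨hγ, hS, fun t ht w hw => ?_⟩
    rw [hprod hγ hS ht, hacc₁ t ht _ hw.1, hacc₂ t ht _ hw.2]
    simp

end Geodesics

section Length

variable {E F : Type*} [NormedAddCommGroup E] [NormedSpace ℝ E] [NormedAddCommGroup F]
  [NormedSpace ℝ F] {g : E → E → E → ℝ} {h : F → F → F → ℝ}

/-- The squared speed of the curve `γ`, defined on `[0, 1]`, for the metric `g`. -/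
def sqSpeed (g : E → E → E → ℝ) (γ : ℝ → E) (t : ℝ) : ℝ :=
  g (γ t) (derivWithin γ (Icc 0 1) t) (derivWithin γ (Icc 0 1) t)

theorem curveLength_eq_integral_sqrt_sqSpeed (g : E → E → E → ℝ) (γ : ℝ → E) :
    curveLength g γ = ∫ t in (0 : ℝ)..1, √(sqSpeed g γ t) :=
  rfl

theorem curveLength_congr {γ : ℝ → E} {δ : ℝ → F}
    (hγδ : EqOn (sqSpeed g γ) (sqSpeed h δ) (Icc 0 1)) : curveLength g γ = curveLength h δ :=
  intervalIntegral.integral_congr fun t ht => by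
    rw [uIcc_of_le zero_le_one] at ht
    exact congrArg Real.sqrt (hγδ ht)

theorem curveLength_eq_sqrt_of_sqSpeed_eq {γ : ℝ → E} {c : ℝ}
    (hγ : ∀ t ∈ Icc (0 : ℝ) 1, sqSpeed g γ t = c) : curveLength g γ = √c := by
  have hconst : curveLength g γ = ∫ _ in (0 : ℝ)..1, √c :=
    intervalIntegral.integral_congr fun t ht => by
      rw [uIcc_of_le zero_le_one] at ht
      exact congrArg Real.sqrt (hγ t ht)
  simpa using hconst

theorem sqrt_sq_integral_add_sq_integral_le {f₁ f₂ : ℝ → ℝ} (hf₁ : ContinuousOn f₁ (Icc 0 1))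
    (hf₂ : ContinuousOn f₂ (Icc 0 1)) :
    √((∫ t in (0 : ℝ)..1, f₁ t) ^ 2 + (∫ t in (0 : ℝ)..1, f₂ t) ^ 2) ≤
      ∫ t in (0 : ℝ)..1, √(f₁ t ^ 2 + f₂ t ^ 2) := by
  have hi₁ : IntervalIntegrable (fun t => (f₁ t : ℂ)) MeasureTheory.volume 0 1 :=
    (Complex.continuous_ofReal.comp_continuousOn hf₁).intervalIntegrable_of_Icc zero_le_one
  have hi₂ : IntervalIntegrable (fun t => (f₂ t * Complex.I : ℂ)) MeasureTheory.volume 0 1 :=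
    ((Complex.continuous_ofReal.comp_continuousOn hf₂).mul
      continuousOn_const).intervalIntegrable_of_Icc zero_le_one
  have hle := intervalIntegral.norm_integral_le_integral_norm (μ := MeasureTheory.volume)
    (f := fun t => (f₁ t + f₂ t * Complex.I : ℂ)) (zero_le_one' ℝ)
  rw [intervalIntegral.integral_add hi₁ hi₂, intervalIntegral.integral_mul_const,
    intervalIntegral.integral_ofReal, intervalIntegral.integral_ofReal] at hle
  simpa only [Complex.norm_add_mul_I] using hle

theorem sqSpeed_prodMetric (a b : ℝ) {γ : ℝ → E × F} {t : ℝ}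
    (hγ : DifferentiableWithinAt ℝ γ (Icc 0 1) t) (ht : t ∈ Icc (0 : ℝ) 1) :
    sqSpeed (prodMetric a g b h) γ t =
      a * sqSpeed g (fun t => (γ t).1) t + b * sqSpeed h (fun t => (γ t).2) t := by
  have hu := uniqueDiffOn_Icc zero_lt_one t ht
  simp only [sqSpeed, prodMetric, derivWithin_fst hγ hu, derivWithin_snd hγ hu]

theorem sqrt_le_curveLength_prodMetric {a b : ℝ} (ha : 0 ≤ a) (hb : 0 ≤ b) {γ : ℝ → E × F}
    (hγ : DifferentiableOn ℝ γ (Icc 0 1))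
    (hg : ContinuousOn (sqSpeed g fun t => (γ t).1) (Icc 0 1))
    (hh : ContinuousOn (sqSpeed h fun t => (γ t).2) (Icc 0 1))
    (hg₀ : ∀ t ∈ Icc (0 : ℝ) 1, 0 ≤ sqSpeed g (fun t => (γ t).1) t)
    (hh₀ : ∀ t ∈ Icc (0 : ℝ) 1, 0 ≤ sqSpeed h (fun t => (γ t).2) t) :
    √(a * curveLength g (fun t => (γ t).1) ^ 2 + b * curveLength h (fun t => (γ t).2) ^ 2) ≤
      curveLength (prodMetric a g b h) γ := by
  calc _ = √((∫ t in (0 : ℝ)..1, √a * √(sqSpeed g (fun t => (γ t).1) t)) ^ 2 +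
          (∫ t in (0 : ℝ)..1, √b * √(sqSpeed h (fun t => (γ t).2) t)) ^ 2) := by
        simp only [curveLength_eq_integral_sqrt_sqSpeed, intervalIntegral.integral_const_mul,
          mul_pow, Real.sq_sqrt ha, Real.sq_sqrt hb]
    _ ≤ ∫ t in (0 : ℝ)..1, √((√a * √(sqSpeed g (fun t => (γ t).1) t)) ^ 2 +
          (√b * √(sqSpeed h (fun t => (γ t).2) t)) ^ 2) :=
        sqrt_sq_integral_add_sq_integral_le (hg.sqrt.const_mul _) (hh.sqrt.const_mul _)
    _ = curveLength (prodMetric a g b h) γ :=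
        intervalIntegral.integral_congr fun t ht => by
          rw [uIcc_of_le zero_le_one] at ht
          simp only [mul_pow, Real.sq_sqrt ha, Real.sq_sqrt hb, Real.sq_sqrt (hg₀ t ht),
            Real.sq_sqrt (hh₀ t ht)]
          exact congrArg Real.sqrt (sqSpeed_prodMetric a b (hγ t ht) ht).symm

theorem sub_le_integral_of_deriv_sq_le {a b : ℝ} {u u' σ : ℝ → ℝ} (hab : a ≤ b)
    (hu₀ : ∀ t ∈ Icc a b, 0 ≤ u t) (hσ₀ : ∀ t ∈ Icc a b, 0 ≤ σ t)
    (hu : ∀ t ∈ Icc a b, HasDerivWithinAt (fun t => u t ^ 2) (u' t) (Icc a b) t)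
    (hσ : ContinuousOn σ (Icc a b)) (hle : ∀ t ∈ Icc a b, u' t ≤ 2 * u t * σ t) :
    u b - u a ≤ ∫ t in a..b, σ t := by
  refine le_of_forall_pos_le_add fun ε hε => ?_
  have hpos : ∀ t, 0 < u t ^ 2 + ε ^ 2 := fun t => by positivity
  have hle_sqrt : ∀ t ∈ Icc a b, u t ≤ √(u t ^ 2 + ε ^ 2) := fun t _ =>
    Real.le_sqrt_of_sq_le (le_add_of_nonneg_right (sq_nonneg ε))
  have hsqrt : ∀ t ∈ Icc a b, HasDerivWithinAt (fun t => √(u t ^ 2 + ε ^ 2))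
      (u' t / (2 * √(u t ^ 2 + ε ^ 2))) (Icc a b) t := fun t ht =>
    ((hu t ht).add_const _).sqrt (hpos t).ne'
  have hrate : ∀ t ∈ Ioo a b, u' t / (2 * √(u t ^ 2 + ε ^ 2)) ≤ σ t := fun t ht => by
    have ht' := Ioo_subset_Icc_self ht
    rw [div_le_iff₀ (mul_pos two_pos (Real.sqrt_pos.2 (hpos t)))]
    linarith [hle t ht', mul_le_mul_of_nonneg_right (hle_sqrt t ht') (hσ₀ t ht')]
  have hint := intervalIntegral.sub_le_integral_of_hasDeriv_right_of_le hab
    (fun t ht => (hsqrt t ht).continuousWithinAt)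
    (fun t ht => ((hsqrt t (Ioo_subset_Icc_self ht)).hasDerivAt
      (Icc_mem_nhds ht.1 ht.2)).hasDerivWithinAt) hσ.integrableOn_Icc hrate
  have ha : √(u a ^ 2 + ε ^ 2) ≤ u a + ε := by
    have hua := hu₀ a (left_mem_Icc.2 hab)
    exact Real.sqrt_le_iff.2 ⟨by positivity, by nlinarith⟩
  linarith [hle_sqrt b (right_mem_Icc.2 hab)]

end Length

section TraceMetric

variable {R : Type*} [NormedRing R] [NormedAlgebra ℝ R] {φ : R →L[ℝ] ℝ} {x : R}
  {γ : ℝ → R} {J : Set ℝ} {t : ℝ}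

/-- The metric `φ (x⁻¹ v x⁻¹ w)` on the units `x` of a Banach algebra, for a linear functional `φ`
playing the role of a trace. It is affine-invariant as soon as `φ (x y) = φ (y x)`. -/
def traceMetric (φ : R →L[ℝ] ℝ) (x v w : R) : ℝ :=
  φ (x⁻¹ʳ * v * x⁻¹ʳ * w)

/-- The acceleration `γ'' - γ' γ⁻¹ γ'` of a curve of units of a Banach algebra for the connection
whose geodesics are the curves `x exp (t a)`. -/
def algAccel (γ : ℝ → R) (J : Set ℝ) (t : ℝ) : R :=
  derivWithin (derivWithin γ J) J t - derivWithin γ J t * (γ t)⁻¹ʳ * derivWithin γ J t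

/-- The curve `x exp (t x⁻¹ v)` in the units of a Banach algebra. -/
def expLine (x v : R) (t : ℝ) : R :=
  x * NormedSpace.exp (t • (x⁻¹ʳ * v))

theorem traceMetric_conj (hφ : ∀ a b, φ (a * b) = φ (b * a)) {a b : R} (ha : IsUnit a)
    (hb : IsUnit b) (x v w : R) :
    traceMetric φ (a * x * b) (a * v * b) (a * w * b) = traceMetric φ x v w := by
  have hinv : (a * x * b)⁻¹ʳ = b⁻¹ʳ * x⁻¹ʳ * a⁻¹ʳ := by
    rw [Ring.inverse_mul (.inr hb), Ring.inverse_mul (.inl ha), mul_assoc]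
  calc φ ((a * x * b)⁻¹ʳ * (a * v * b) * (a * x * b)⁻¹ʳ * (a * w * b))
      = φ (b⁻¹ʳ * x⁻¹ʳ * (a⁻¹ʳ * a) * v * (b * b⁻¹ʳ) * x⁻¹ʳ * (a⁻¹ʳ * a) * w * b) := by
        rw [hinv]
        simp only [mul_assoc]
    _ = φ (b⁻¹ʳ * (x⁻¹ʳ * v * x⁻¹ʳ * w * b)) := by
        simp only [Ring.inverse_mul_cancel _ ha, Ring.mul_inverse_cancel _ hb, mul_one, mul_assoc]
    _ = φ (x⁻¹ʳ * v * x⁻¹ʳ * w) := by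
        rw [hφ, mul_assoc, Ring.mul_inverse_cancel _ hb, mul_one]

theorem traceMetric_mul_mul (hx : IsUnit x) (a b : R) :
    traceMetric φ x (x * a) (x * b) = φ (a * b) := by
  rw [traceMetric, Ring.inverse_mul_cancel_left _ _ hx, mul_assoc,
    Ring.inverse_mul_cancel_left _ _ hx]

theorem expLine_zero (x v : R) : expLine x v 0 = x := by
  simp [expLine]

variable [CompleteSpace R]

theorem hasDerivWithinAt_ringInverse {γ' : R} (hγ : HasDerivWithinAt γ γ' J t)
    (hu : IsUnit (γ t)) :
    HasDerivWithinAt (fun r => (γ r)⁻¹ʳ) (-((γ t)⁻¹ʳ * γ' * (γ t)⁻¹ʳ)) J t := by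
  obtain ⟨u, hu⟩ := hu
  have hinv : HasFDerivAt Ring.inverse _ (γ t) := hu ▸ hasFDerivAt_ringInverse (𝕜 := ℝ) u
  convert! hinv.comp_hasDerivWithinAt t hγ using 1
  simp [← hu]

theorem contDiffOn_ringInverse {k : WithTop ℕ∞} (hγ : ContDiffOn ℝ k γ J)
    (hu : ∀ r ∈ J, IsUnit (γ r)) : ContDiffOn ℝ k (fun r => (γ r)⁻¹ʳ) J := fun r hr => by
  obtain ⟨u, hu⟩ := hu r hr
  have hinv : ContDiffAt ℝ k Ring.inverse (γ r) := hu ▸ contDiffAt_ringInverse ℝ u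
  exact hinv.comp_contDiffWithinAt r (hγ r hr)

theorem hasLineDerivAt_traceMetric (hx : IsUnit x) (v w u : R) :
    HasLineDerivAt ℝ (fun y => traceMetric φ y v w)
      (-φ (x⁻¹ʳ * u * x⁻¹ʳ * v * x⁻¹ʳ * w) - φ (x⁻¹ʳ * v * x⁻¹ʳ * u * x⁻¹ʳ * w)) x u := by
  have hline : HasDerivWithinAt (fun t : ℝ => x + t • u) u univ 0 := by
    simpa using ((hasDerivAt_id (0 : ℝ)).smul_const u).const_add x
  have hinv := hasDerivWithinAt_ringInverse hline (by simpa using hx)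
  have hmul := φ.hasFDerivAt.comp_hasDerivWithinAt 0 (((hinv.mul_const v).mul hinv).mul_const w)
  rw [HasLineDerivAt, ← hasDerivWithinAt_univ]
  convert! hmul using 1
  simp only [zero_smul, add_zero, neg_mul, mul_neg, add_mul, map_add, map_neg, mul_assoc,
    sub_eq_add_neg]

theorem christoffel_traceMetric_self (hφ : ∀ a b, φ (a * b) = φ (b * a)) (hx : IsUnit x)
    (v w : R) :
    christoffel (traceMetric φ) x v v w = -φ (x⁻¹ʳ * v * x⁻¹ʳ * v * x⁻¹ʳ * w) := by
  have hrot : φ (x⁻¹ʳ * w * x⁻¹ʳ * v * x⁻¹ʳ * v) = φ (x⁻¹ʳ * v * x⁻¹ʳ * v * x⁻¹ʳ * w) := by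
    simpa only [mul_assoc] using hφ (x⁻¹ʳ * w) (x⁻¹ʳ * v * x⁻¹ʳ * v)
  have hrot' : φ (x⁻¹ʳ * v * x⁻¹ʳ * w * x⁻¹ʳ * v) = φ (x⁻¹ʳ * v * x⁻¹ʳ * v * x⁻¹ʳ * w) := by
    simpa only [mul_assoc] using hφ (x⁻¹ʳ * v * x⁻¹ʳ * w) (x⁻¹ʳ * v)
  rw [christoffel, (hasLineDerivAt_traceMetric hx v w v).lineDeriv,
    (hasLineDerivAt_traceMetric hx v v w).lineDeriv, hrot, hrot']
  ring

theorem accelInner_traceMetric (hφ : ∀ a b, φ (a * b) = φ (b * a)) (hu : IsUnit (γ t)) (w : R) :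
    accelInner (traceMetric φ) γ J t w = traceMetric φ (γ t) (algAccel γ J t) w := by
  rw [accelInner, christoffel_traceMetric_self hφ hu, traceMetric, traceMetric, algAccel]
  simp only [mul_sub, sub_mul, map_sub, mul_assoc, ← sub_eq_add_neg]

theorem isGeodesicOn_traceMetric_of_algAccel_eq_zero (hφ : ∀ a b, φ (a * b) = φ (b * a))
    {S : Set R} {T : R → Set R} (hS : ∀ x ∈ S, IsUnit x) (hγ : ContDiffOn ℝ ∞ γ J)
    (hγS : MapsTo γ J S) (hacc : ∀ t ∈ J, algAccel γ J t = 0) :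
    IsGeodesicOn S T (traceMetric φ) γ J := by
  refine ⟨hγ, hγS, fun t ht w _ => ?_⟩
  rw [accelInner_traceMetric hφ (hS _ (hγS ht)), hacc t ht]
  simp [traceMetric]

theorem algAccel_eq_zero_of_isGeodesicOn (hφ : ∀ a b, φ (a * b) = φ (b * a))
    {S : Set R} {T : R → Set R} (hS : ∀ x ∈ S, IsUnit x)
    (hdef : ∀ x ∈ S, ∀ v ∈ T x, traceMetric φ x v v = 0 → v = 0)
    (hγ : IsGeodesicOn S T (traceMetric φ) γ J) (ht : t ∈ J) (hT : algAccel γ J t ∈ T (γ t)) :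
    algAccel γ J t = 0 := by
  refine hdef _ (hγ.2.1 ht) _ hT ?_
  rw [← accelInner_traceMetric hφ (hS _ (hγ.2.1 ht))]
  exact hγ.2.2 t ht _ hT

theorem continuousOn_sqSpeed_traceMetric (hγ : ContDiffOn ℝ 1 γ (Icc 0 1))
    (hu : ∀ t ∈ Icc (0 : ℝ) 1, IsUnit (γ t)) :
    ContinuousOn (sqSpeed (traceMetric φ) γ) (Icc 0 1) := by
  have hγ' : ContinuousOn (derivWithin γ (Icc 0 1)) (Icc 0 1) :=
    hγ.continuousOn_derivWithin (uniqueDiffOn_Icc zero_lt_one) le_rfl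
  have hinv := (contDiffOn_ringInverse hγ hu).continuousOn
  exact φ.continuous.comp_continuousOn (((hinv.mul hγ').mul hinv).mul hγ')

theorem hasDerivWithinAt_inverse_mul_derivWithin (hγ : DifferentiableWithinAt ℝ γ J t)
    (hγ' : DifferentiableWithinAt ℝ (derivWithin γ J) J t) (hu : IsUnit (γ t)) :
    HasDerivWithinAt (fun r => (γ r)⁻¹ʳ * derivWithin γ J r) ((γ t)⁻¹ʳ * algAccel γ J t) J t := by
  convert! (hasDerivWithinAt_ringInverse hγ.hasDerivWithinAt hu).mul hγ'.hasDerivWithinAt using 1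
  simp only [algAccel, mul_sub, neg_mul, mul_assoc]
  abel

theorem hasDerivAt_expLine (x v : R) (t : ℝ) :
    HasDerivAt (expLine x v) (expLine x v t * (x⁻¹ʳ * v)) t := by
  simpa only [expLine, mul_assoc] using!
    (hasDerivAt_exp_smul_const (𝕂 := ℝ) (x⁻¹ʳ * v) t).const_mul x

theorem hasDerivAt_expLine_zero (hx : IsUnit x) (v : R) : HasDerivAt (expLine x v) v 0 := by
  simpa only [expLine_zero, Ring.mul_inverse_cancel_left _ _ hx] using hasDerivAt_expLine x v 0

theorem contDiff_expLine (x v : R) : ContDiff ℝ ∞ (expLine x v) := by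
  have hexp : ContDiff ℝ ∞ (NormedSpace.exp : R → R) :=
    contDiff_iff_contDiffAt.2 fun a => (NormedSpace.exp_analytic (𝕂 := ℝ) a).contDiffAt
  exact contDiff_const.mul (hexp.comp (contDiff_id.smul contDiff_const))

theorem isUnit_expLine (hx : IsUnit x) (v : R) (t : ℝ) : IsUnit (expLine x v t) :=
  letI : NormedAlgebra ℚ R := NormedAlgebra.restrictScalars ℚ ℝ R
  hx.mul (NormedSpace.isUnit_exp _)

theorem derivWithin_expLine (x v : R) (hJ : UniqueDiffWithinAt ℝ J t) :
    derivWithin (expLine x v) J t = expLine x v t * (x⁻¹ʳ * v) :=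
  (hasDerivAt_expLine x v t).hasDerivWithinAt.derivWithin hJ

theorem algAccel_expLine (hx : IsUnit x) (v : R) (hJ : UniqueDiffOn ℝ J) (ht : t ∈ J) :
    algAccel (expLine x v) J t = 0 := by
  have hderiv : EqOn (derivWithin (expLine x v) J) (fun r => expLine x v r * (x⁻¹ʳ * v)) J :=
    fun r hr => derivWithin_expLine x v (hJ r hr)
  rw [algAccel, derivWithin_congr hderiv (hderiv ht), derivWithin_expLine x v (hJ t ht),
    ((hasDerivAt_expLine x v t).mul_const _).hasDerivWithinAt.derivWithin (hJ t ht),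
    mul_assoc _ _ (expLine x v t * _),
    Ring.inverse_mul_cancel_left _ _ (isUnit_expLine hx v t), sub_self]

theorem sqSpeed_traceMetric_expLine (hx : IsUnit x) (v : R) (ht : t ∈ Icc (0 : ℝ) 1) :
    sqSpeed (traceMetric φ) (expLine x v) t = traceMetric φ x v v := by
  have hv : traceMetric φ x v v = φ (x⁻¹ʳ * v * (x⁻¹ʳ * v)) := by
    simp only [traceMetric, mul_assoc]
  rw [sqSpeed, derivWithin_expLine x v (uniqueDiffOn_Icc zero_lt_one t ht),
    traceMetric_mul_mul (isUnit_expLine hx v t), hv]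

theorem eqOn_expLine_of_algAccel_eq_zero (hJ : J.OrdConnected) (hJ' : J.Nontrivial)
    (hγ : ContDiffOn ℝ 2 γ J) (hu : ∀ t ∈ J, IsUnit (γ t)) (hacc : ∀ t ∈ J, algAccel γ J t = 0)
    (h₀ : 0 ∈ J) : EqOn γ (expLine (γ 0) (derivWithin γ J 0)) J := by
  have hJu := uniqueDiffOn_of_ordConnected hJ hJ'
  have hd : DifferentiableOn ℝ γ J := hγ.differentiableOn (by simp)
  have hd' : DifferentiableOn ℝ (derivWithin γ J) J :=
    (hγ.derivWithin (m := 1) hJu (by norm_num)).differentiableOn (by simp)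
  set v := derivWithin γ J 0
  have hlog : ∀ t ∈ J, (γ t)⁻¹ʳ * derivWithin γ J t = (γ 0)⁻¹ʳ * v := fun t ht =>
    eq_of_hasDerivWithinAt_zero (f := fun r => (γ r)⁻¹ʳ * derivWithin γ J r) hJ.convex
      (fun r hr => by
        simpa [hacc r hr] using
          hasDerivWithinAt_inverse_mul_derivWithin (hd r hr) (hd' r hr) (hu r hr)) h₀ ht
  have hγ' : ∀ t ∈ J, HasDerivWithinAt γ (γ t * ((γ 0)⁻¹ʳ * v)) J t := fun t ht => by
    rw [← hlog t ht, Ring.mul_inverse_cancel_left _ _ (hu t ht)]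
    exact (hd t ht).hasDerivWithinAt
  have he : ∀ t, IsUnit (expLine (γ 0) v t) := isUnit_expLine (hu 0 h₀) v
  have hratio : ∀ t ∈ J, γ t * (expLine (γ 0) v t)⁻¹ʳ = γ 0 * (expLine (γ 0) v 0)⁻¹ʳ :=
    fun t ht => eq_of_hasDerivWithinAt_zero (f := fun r => γ r * (expLine (γ 0) v r)⁻¹ʳ) hJ.convex
      (fun r hr => by
        convert! (hγ' r hr).mul (hasDerivWithinAt_ringInverse
          (hasDerivAt_expLine (γ 0) v r).hasDerivWithinAt (he r)) using 1
        rw [Ring.inverse_mul_cancel_left _ _ (he r), mul_neg, mul_assoc, add_neg_cancel]) h₀ ht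
  intro t ht
  rw [expLine_zero, Ring.mul_inverse_cancel _ (hu 0 h₀)] at hratio
  rw [← one_mul (expLine _ _ t), ← hratio t ht, Ring.inverse_mul_cancel_right _ _ (he t)]

end TraceMetric

section Matrices

variable {m : Type*} {A B P : Matrix m m ℂ}

theorem isHermitian_smul (t : ℝ) (hA : A.IsHermitian) : (t • A).IsHermitian := by
  rw [Matrix.IsHermitian, Matrix.conjTranspose_smul, hA.eq, star_trivial]

variable [Fintype m]

theorem isHermitian_conj (hP : P.IsHermitian) (hB : B.IsHermitian) :
    (P * B * P).IsHermitian := by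
  simp only [Matrix.IsHermitian, Matrix.conjTranspose_mul, hP.eq, hB.eq, mul_assoc]

theorem im_trace_mul_eq_zero (hA : A.IsHermitian) (hB : B.IsHermitian) :
    (A * B).trace.im = 0 := by
  refine Complex.conj_eq_iff_im.1 ?_
  rw [← Complex.star_def, ← Matrix.trace_conjTranspose, Matrix.conjTranspose_mul, hA.eq, hB.eq,
    Matrix.trace_mul_comm]

theorem re_trace_conjTranspose_mul_self (A : Matrix m m ℂ) :
    (A.conjTranspose * A).trace.re = ‖A‖ ^ 2 := by
  have hnorm : ‖A‖ ^ 2 = ∑ j, ∑ i, ‖A i j‖ ^ 2 := by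
    have hsum : 0 ≤ ∑ i, ∑ j, ‖A i j‖ ^ (2 : ℝ) := by positivity
    rw [Matrix.frobenius_norm_def, ← Real.sqrt_eq_rpow, Real.sq_sqrt hsum, Finset.sum_comm]
    simp only [Real.rpow_two]
  simp only [hnorm, Matrix.trace, Matrix.diag_apply, Matrix.mul_apply,
    Matrix.conjTranspose_apply, Complex.re_sum, Complex.star_def, Complex.conj_mul',
    ← Complex.ofReal_pow, Complex.ofReal_re]

theorem re_trace_mul_self (hA : A.IsHermitian) : (A * A).trace.re = ‖A‖ ^ 2 := by
  rw [← re_trace_conjTranspose_mul_self, hA.eq]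

theorem re_trace_mul_le_norm_mul_norm (hA : A.IsHermitian) (hB : B.IsHermitian) :
    (A * B).trace.re ≤ ‖A‖ * ‖B‖ := by
  have hpolar : 2 * (A * B).trace.re = ‖A + B‖ ^ 2 - ‖A‖ ^ 2 - ‖B‖ ^ 2 := by
    rw [← re_trace_mul_self hA, ← re_trace_mul_self hB, ← re_trace_mul_self (hA.add hB)]
    simp only [add_mul, mul_add, Matrix.trace_add, Complex.add_re, Matrix.trace_mul_comm B A]
    ring
  have htri := pow_le_pow_left₀ (norm_nonneg _) (norm_add_le A B) 2
  linarith

variable [DecidableEq m]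

theorem continuousOn_spectrum (f : ℝ → ℝ) (A : Matrix m m ℂ) : ContinuousOn f (spectrum ℝ A) :=
  A.finite_real_spectrum.continuousOn f

theorem pos_of_mem_spectrum (hA : A.PosDef) {x : ℝ} (hx : x ∈ spectrum ℝ A) : 0 < x := by
  rw [hA.isHermitian.spectrum_real_eq_range_eigenvalues] at hx
  obtain ⟨i, rfl⟩ := hx
  exact hA.eigenvalues_pos i

theorem isHermitian_cfc (f : ℝ → ℝ) (A : Matrix m m ℂ) : (cfc f A).IsHermitian :=
  cfc_predicate (p := IsSelfAdjoint) f A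

theorem cfc_mul_cfc (f g : ℝ → ℝ) (A : Matrix m m ℂ) :
    cfc f A * cfc g A = cfc (fun x => f x * g x) A :=
  (cfc_mul f g A (continuousOn_spectrum f A) (continuousOn_spectrum g A)).symm

theorem cfc_id_of_isHermitian (hA : A.IsHermitian) : cfc (fun x : ℝ => x) A = A :=
  cfc_id' ℝ A hA

theorem cfc_one_of_isHermitian (hA : A.IsHermitian) : cfc (fun _ : ℝ => (1 : ℝ)) A = 1 :=
  cfc_const_one ℝ A hA

theorem cfc_inv_of_posDef (hA : A.PosDef) : cfc (fun x : ℝ => x⁻¹) A = A⁻¹ := by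
  refine (Matrix.inv_eq_left_inv ?_).symm
  nth_rw 2 [← cfc_id_of_isHermitian hA.isHermitian]
  rw [cfc_mul_cfc, ← cfc_one_of_isHermitian hA.isHermitian]
  exact cfc_congr fun x hx => inv_mul_cancel₀ (pos_of_mem_spectrum hA hx).ne'

theorem exp_eq_cfc (hA : A.IsHermitian) : NormedSpace.exp A = cfc Real.exp A :=
  (@CFC.real_exp_eq_normedSpace_exp (Matrix m m ℂ) _ _ _
    Matrix.IsHermitian.instContinuousFunctionalCalculus A hA).symm

theorem cfc_eq_conj_diagonal (hA : A.IsHermitian) (f : ℝ → ℝ) :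
    cfc f A = hA.eigenvectorUnitary.1 *
      Matrix.diagonal (fun i => (f (hA.eigenvalues i) : ℂ)) * star hA.eigenvectorUnitary.1 := by
  rw [hA.cfc_eq, Matrix.IsHermitian.cfc, Unitary.conjStarAlgAut_apply]
  rfl

theorem det_exp_of_isHermitian (hA : A.IsHermitian) :
    (NormedSpace.exp A).det = Complex.exp A.trace := by
  have htrace : A.trace = ∑ i, (hA.eigenvalues i : ℂ) := hA.trace_eq_sum_eigenvalues
  rw [exp_eq_cfc hA, cfc_eq_conj_diagonal hA, Matrix.det_mul_right_comm,
    Unitary.mul_star_self_of_mem hA.eigenvectorUnitary.2, one_mul, Matrix.det_diagonal, htrace,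
    Complex.exp_sum]
  simp only [Complex.ofReal_exp]

theorem posDef_exp (hA : A.IsHermitian) : (NormedSpace.exp A).PosDef := by
  have hhalf := isHermitian_smul (1 / 2) hA
  have hsq : NormedSpace.exp A = (NormedSpace.exp ((1 / 2 : ℝ) • A)).conjTranspose *
      NormedSpace.exp ((1 / 2 : ℝ) • A) := by
    rw [hhalf.exp.eq, ← Matrix.exp_add_of_commute _ _ (Commute.refl _), ← add_smul, add_halves,
      one_smul]
  rw [hsq]
  exact Matrix.PosDef.conjTranspose_mul_self _
    (Matrix.mulVec_injective_of_isUnit (Matrix.isUnit_exp _))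

theorem posDef_conj (hP : P.IsHermitian) (hu : IsUnit P) (hB : B.PosDef) :
    (P * B * P).PosDef := by
  have hconj := (Matrix.IsUnit.posDef_star_left_conjugate_iff (x := B) hu).2 hB
  rwa [Matrix.star_eq_conjTranspose, hP.eq] at hconj

/- The weights are the squared moduli of the entries of the unitary matrix relating the two
eigenbases. -/
theorem exists_weights_re_trace_cfc_mul_cfc (hA : A.IsHermitian) (hB : B.IsHermitian) :
    ∃ w : m → m → ℝ, (∀ i j, 0 ≤ w i j) ∧ ∀ f g : ℝ → ℝ,
      (cfc f A * cfc g B).trace.re =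
        ∑ i, ∑ j, w i j * (f (hA.eigenvalues i) * g (hB.eigenvalues j)) := by
  set W := star hA.eigenvectorUnitary.1 * hB.eigenvectorUnitary.1
  refine ⟨fun i j => Complex.normSq (W i j), fun _ _ => Complex.normSq_nonneg _, fun f g => ?_⟩
  set D : Matrix m m ℂ := Matrix.diagonal fun i => (f (hA.eigenvalues i) : ℂ)
  set F : Matrix m m ℂ := Matrix.diagonal fun i => (g (hB.eigenvalues i) : ℂ)
  have htrace : (cfc f A * cfc g B).trace = ((D * W) * (F * star W)).trace := by
    rw [cfc_eq_conj_diagonal hA, cfc_eq_conj_diagonal hB, star_mul, star_star]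
    simp only [mul_assoc]
    rw [Matrix.trace_mul_comm]
    simp only [W, D, F, mul_assoc]
  have hentry (a b : ℝ) (z : ℂ) : ((a * z) * (b * star z) : ℂ).re = Complex.normSq z * (a * b) := by
    rw [mul_mul_mul_comm, Complex.star_def, Complex.mul_conj, ← Complex.ofReal_mul,
      ← Complex.ofReal_mul, Complex.ofReal_re, mul_comm]
  rw [htrace]
  simp only [Matrix.trace, Matrix.diag_apply, Matrix.mul_apply (M := D * W), Complex.re_sum]
  refine Finset.sum_congr rfl fun i _ => Finset.sum_congr rfl fun j _ => ?_
  rw [Matrix.diagonal_mul, Matrix.diagonal_mul, Matrix.star_apply, hentry]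

end Matrices

section Powers

variable {p : ℕ} {A B : Matrix (Fin p) (Fin p) ℂ}

theorem isHermitian_hlog (A : Matrix (Fin p) (Fin p) ℂ) : (hlog A).IsHermitian :=
  isHermitian_cfc _ _

theorem isHermitian_hpow (A : Matrix (Fin p) (Fin p) ℂ) (t : ℝ) : (hpow A t).IsHermitian :=
  isHermitian_cfc _ _

theorem hpow_eq_exp_smul_hlog (hA : A.PosDef) (t : ℝ) :
    hpow A t = NormedSpace.exp (t • hlog A) := by
  rw [exp_eq_cfc (isHermitian_smul t (isHermitian_hlog A)), hlog, hpow,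
    ← cfc_smul t Real.log A (continuousOn_spectrum _ _),
    ← cfc_comp' Real.exp (fun x => t • Real.log x) A
      (by exact Real.continuous_exp.continuousOn) (continuousOn_spectrum _ _)
      (by exact hA.isHermitian)]
  refine cfc_congr fun x hx => ?_
  rw [Real.rpow_def_of_pos (pos_of_mem_spectrum hA hx), mul_comm, smul_eq_mul]

theorem hpow_zero (hA : A.IsHermitian) : hpow A 0 = 1 := by
  simpa only [hpow, Real.rpow_zero] using cfc_one_of_isHermitian hA

theorem hpow_one (hA : A.IsHermitian) : hpow A 1 = A := by
  simpa only [hpow, Real.rpow_one] using cfc_id_of_isHermitian hA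

theorem hpow_mul_hpow (hA : A.PosDef) (s t : ℝ) : hpow A s * hpow A t = hpow A (s + t) := by
  rw [hpow, hpow, cfc_mul_cfc, hpow]
  exact cfc_congr fun x hx => (Real.rpow_add (pos_of_mem_spectrum hA hx) s t).symm

theorem hpow_half_mul_hpow_half (hA : A.PosDef) : hpow A (1 / 2) * hpow A (1 / 2) = A := by
  rw [hpow_mul_hpow hA, add_halves, hpow_one hA.isHermitian]

theorem hpow_mul_hpow_neg (hA : A.PosDef) (t : ℝ) : hpow A t * hpow A (-t) = 1 := by
  rw [hpow_mul_hpow hA, add_neg_cancel, hpow_zero hA.isHermitian]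

theorem hpow_neg_mul_hpow (hA : A.PosDef) (t : ℝ) : hpow A (-t) * hpow A t = 1 := by
  rw [hpow_mul_hpow hA, neg_add_cancel, hpow_zero hA.isHermitian]

theorem hpow_neg_half_mul_hpow_neg_half (hA : A.PosDef) :
    hpow A (-(1 / 2)) * hpow A (-(1 / 2)) = A⁻¹ := by
  refine (Matrix.inv_eq_left_inv ?_).symm
  nth_rw 3 [← hpow_one hA.isHermitian]
  rw [hpow_mul_hpow hA, hpow_mul_hpow hA, ← hpow_zero hA.isHermitian]
  norm_num

theorem isUnit_hpow (hA : A.PosDef) (t : ℝ) : IsUnit (hpow A t) := by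
  rw [hpow_eq_exp_smul_hlog hA]
  exact Matrix.isUnit_exp _

theorem hlog_exp (hA : A.IsHermitian) : hlog (NormedSpace.exp A) = A :=
  @CFC.log_exp (Matrix (Fin p) (Fin p) ℂ) _ _ _
    Matrix.IsHermitian.instContinuousFunctionalCalculus A hA

theorem hlog_one : hlog (1 : Matrix (Fin p) (Fin p) ℂ) = 0 := by
  simpa only [NormedSpace.exp_zero] using
    hlog_exp (Matrix.isHermitian_zero (n := Fin p) (α := ℂ))

theorem trace_hlog (hA : A ∈ SHPD p) : (hlog A).trace = 0 := by
  have hreal : ((hlog A).trace.re : ℂ) = (hlog A).trace :=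
    Complex.ext rfl (by simpa using
      (im_trace_mul_eq_zero (isHermitian_hlog A) Matrix.isHermitian_one).symm)
  have hexp := det_exp_of_isHermitian (isHermitian_hlog A)
  rw [← one_smul ℝ (hlog A), ← hpow_eq_exp_smul_hlog hA.1, hpow_one hA.1.isHermitian, hA.2,
    one_smul, ← hreal, ← Complex.ofReal_exp] at hexp
  have hzero : (hlog A).trace.re = 0 := (Real.exp_eq_one_iff _).1 (by exact_mod_cast hexp.symm)
  rw [← hreal, hzero, Complex.ofReal_zero]

theorem posDef_whiten (hA : A.PosDef) (hB : B.PosDef) : (whiten A B).PosDef :=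
  posDef_conj (isHermitian_hpow _ _) (isUnit_hpow hA _) hB

theorem isHermitian_whiten (hB : B.IsHermitian) : (whiten A B).IsHermitian :=
  isHermitian_conj (isHermitian_hpow _ _) hB

theorem whiten_self (hA : A.PosDef) : whiten A A = 1 := by
  nth_rw 2 [← hpow_half_mul_hpow_half hA]
  rw [whiten, ← mul_assoc, hpow_neg_mul_hpow hA, one_mul, hpow_mul_hpow_neg hA]

theorem hpow_half_mul_whiten_mul_hpow_half (hA : A.PosDef) (B : Matrix (Fin p) (Fin p) ℂ) :
    hpow A (1 / 2) * whiten A B * hpow A (1 / 2) = B := by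
  rw [whiten, mul_assoc, mul_assoc, hpow_neg_mul_hpow hA, mul_one, ← mul_assoc,
    hpow_mul_hpow_neg hA, one_mul]

theorem whiten_hpow_half_mul_mul_hpow_half (hA : A.PosDef) (B : Matrix (Fin p) (Fin p) ℂ) :
    whiten A (hpow A (1 / 2) * B * hpow A (1 / 2)) = B := by
  rw [whiten, mul_assoc, mul_assoc, hpow_mul_hpow_neg hA, mul_one, ← mul_assoc,
    hpow_neg_mul_hpow hA, one_mul]

theorem trace_whiten (hA : A.PosDef) (B : Matrix (Fin p) (Fin p) ℂ) :
    (whiten A B).trace = (A⁻¹ * B).trace := by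
  rw [whiten, Matrix.trace_mul_cycle, hpow_neg_half_mul_hpow_neg_half hA]

theorem det_hpow_half_mul_mul_hpow_half (hA : A ∈ SHPD p) (B : Matrix (Fin p) (Fin p) ℂ) :
    (hpow A (1 / 2) * B * hpow A (1 / 2)).det = B.det := by
  rw [Matrix.det_mul_right_comm, hpow_half_mul_hpow_half hA.1, Matrix.det_mul, hA.2, one_mul]

theorem whiten_mem_SHPD (hA : A ∈ SHPD p) (hB : B ∈ SHPD p) : whiten A B ∈ SHPD p :=
  ⟨posDef_whiten hA.1 hB.1, by
    rw [← det_hpow_half_mul_mul_hpow_half hA, hpow_half_mul_whiten_mul_hpow_half hA.1, hB.2]⟩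

theorem hpow_half_mul_mul_hpow_half_mem_SHPD (hA : A ∈ SHPD p) (hB : B ∈ SHPD p) :
    hpow A (1 / 2) * B * hpow A (1 / 2) ∈ SHPD p :=
  ⟨posDef_conj (isHermitian_hpow _ _) (isUnit_hpow hA.1 _) hB.1, by
    rw [det_hpow_half_mul_mul_hpow_half hA, hB.2]⟩

theorem mul_exp_smul_inv_mul_eq (hA : A.PosDef) (ξ : Matrix (Fin p) (Fin p) ℂ) (t : ℝ) :
    A * NormedSpace.exp (t • (A⁻¹ * ξ)) =
      hpow A (1 / 2) * NormedSpace.exp (t • whiten A ξ) * hpow A (1 / 2) := by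
  have hinv : (hpow A (-(1 / 2)))⁻¹ = hpow A (1 / 2) :=
    Matrix.inv_eq_left_inv (hpow_mul_hpow_neg hA _)
  have hconj : t • (A⁻¹ * ξ) =
      hpow A (-(1 / 2)) * (t • whiten A ξ) * (hpow A (-(1 / 2)))⁻¹ := by
    rw [hinv, whiten, mul_smul_comm, smul_mul_assoc, ← hpow_neg_half_mul_hpow_neg_half hA]
    simp only [mul_assoc, hpow_neg_mul_hpow hA, mul_one]
  have hhalf : A * hpow A (-(1 / 2)) = hpow A (1 / 2) := by
    nth_rw 1 [← hpow_half_mul_hpow_half hA]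
    rw [mul_assoc, hpow_mul_hpow_neg hA, mul_one]
  rw [hconj, Matrix.exp_conj _ _ (isUnit_hpow hA _), hinv, ← mul_assoc, ← mul_assoc, hhalf]

theorem mul_exp_smul_inv_mul_mem_SHPD {ξ : Matrix (Fin p) (Fin p) ℂ} (hA : A ∈ SHPD p)
    (hξ : ξ ∈ tangentSHPD A) (t : ℝ) : A * NormedSpace.exp (t • (A⁻¹ * ξ)) ∈ SHPD p := by
  have hwhiten := isHermitian_smul t (isHermitian_whiten (A := A) hξ.1)
  rw [mul_exp_smul_inv_mul_eq hA.1]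
  refine hpow_half_mul_mul_hpow_half_mem_SHPD hA ⟨posDef_exp hwhiten, ?_⟩
  rw [det_exp_of_isHermitian hwhiten, Matrix.trace_smul, trace_whiten hA.1, hξ.2, smul_zero,
    Complex.exp_zero]

end Powers

section PositiveVectors

variable {n : ℕ} {τ ξ : Fin n → ℝ} {γ : ℝ → Fin n → ℝ} {J : Set ℝ}

theorem isUnit_of_mem_PosVec (hτ : τ ∈ PosVec n) : IsUnit τ :=
  Pi.isUnit_iff.2 fun i => (hτ i).ne'.isUnit

theorem ringInverse_apply (hτ : IsUnit τ) (i : Fin n) : τ⁻¹ʳ i = (τ i)⁻¹ :=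
  eq_inv_of_mul_eq_one_right (congrFun (Ring.mul_inverse_cancel τ hτ) i)

/-- The sum of the coordinates, which plays the role of the trace on `ℝ^n`. -/
def coordSum (n : ℕ) : (Fin n → ℝ) →L[ℝ] ℝ :=
  ∑ i, ContinuousLinearMap.proj i

theorem coordSum_apply (τ : Fin n → ℝ) : coordSum n τ = ∑ i, τ i := by
  simp [coordSum]

theorem coordSum_mul_comm (τ ξ : Fin n → ℝ) : coordSum n (τ * ξ) = coordSum n (ξ * τ) := by
  rw [mul_comm]

theorem metricPosVec_eq_traceMetric (hτ : IsUnit τ) :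
    metricPosVec τ = traceMetric (coordSum n) τ := by
  funext ξ η
  rw [metricPosVec, traceMetric, coordSum_apply]
  refine Finset.sum_congr rfl fun i _ => ?_
  simp only [Pi.mul_apply, ringInverse_apply hτ]
  ring

theorem metricPosVec_eventuallyEq_traceMetric (hτ : IsUnit τ) :
    metricPosVec =ᶠ[𝓝 τ] traceMetric (coordSum n) :=
  (Units.isOpen.eventually_mem hτ).mono fun _ => metricPosVec_eq_traceMetric

theorem metricPosVec_self (τ ξ : Fin n → ℝ) :
    metricPosVec τ ξ ξ = ‖WithLp.toLp 2 fun i => (τ i)⁻¹ * ξ i‖ ^ 2 := by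
  rw [metricPosVec, EuclideanSpace.norm_sq_eq]
  refine Finset.sum_congr rfl fun i _ => ?_
  rw [Real.norm_eq_abs, sq_abs, mul_comm (ξ i), sq]

theorem eq_zero_of_metricPosVec_self_eq_zero (hτ : IsUnit τ) (h : metricPosVec τ ξ ξ = 0) :
    ξ = 0 := by
  rw [metricPosVec_self, sq_eq_zero_iff, norm_eq_zero] at h
  funext i
  have hi : (τ i)⁻¹ * ξ i = 0 := congrFun (congrArg WithLp.ofLp h) i
  exact (mul_eq_zero.1 hi).resolve_left (inv_ne_zero (Pi.isUnit_iff.1 hτ i).ne_zero)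

theorem isGeodesicOn_metricPosVec_iff :
    IsGeodesicOn (PosVec n) tangentPosVec metricPosVec γ J ↔
      IsGeodesicOn (PosVec n) tangentPosVec (traceMetric (coordSum n)) γ J :=
  isGeodesicOn_congr fun _ hτ => metricPosVec_eventuallyEq_traceMetric (isUnit_of_mem_PosVec hτ)

theorem expLine_apply (hτ : IsUnit τ) (ξ : Fin n → ℝ) (t : ℝ) (i : Fin n) :
    expLine τ ξ t i = τ i * Real.exp (t * ((τ i)⁻¹ * ξ i)) := by
  rw [expLine, Pi.mul_apply, Pi.coe_exp, Pi.smul_apply, Pi.mul_apply, ringInverse_apply hτ,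
    Real.exp_eq_exp_ℝ, smul_eq_mul]

theorem expLine_mem_PosVec (hτ : τ ∈ PosVec n) (ξ : Fin n → ℝ) (t : ℝ) :
    expLine τ ξ t ∈ PosVec n := fun i => by
  rw [expLine_apply (isUnit_of_mem_PosVec hτ)]
  exact mul_pos (hτ i) (Real.exp_pos _)

theorem isGeodesicOn_expLine_metricPosVec (hτ : τ ∈ PosVec n) (ξ : Fin n → ℝ)
    (hJ : UniqueDiffOn ℝ J) :
    IsGeodesicOn (PosVec n) tangentPosVec metricPosVec (expLine τ ξ) J :=
  isGeodesicOn_metricPosVec_iff.2 <| isGeodesicOn_traceMetric_of_algAccel_eq_zero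
    coordSum_mul_comm (fun _ => isUnit_of_mem_PosVec) (contDiff_expLine τ ξ).contDiffOn
    (fun t _ => expLine_mem_PosVec hτ ξ t)
    fun _ => algAccel_expLine (isUnit_of_mem_PosVec hτ) ξ hJ

theorem eqOn_expLine_of_isGeodesicOn_metricPosVec (hJ : J.OrdConnected) (hJ' : J.Nontrivial)
    (hγ : IsGeodesicOn (PosVec n) tangentPosVec metricPosVec γ J) (h₀ : 0 ∈ J) :
    EqOn γ (expLine (γ 0) (derivWithin γ J 0)) J := by
  have hdef : ∀ τ ∈ PosVec n, ∀ ξ ∈ tangentPosVec τ, traceMetric (coordSum n) τ ξ ξ = 0 → ξ = 0 :=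
    fun τ hτ ξ _ h => eq_zero_of_metricPosVec_self_eq_zero (isUnit_of_mem_PosVec hτ) <| by
      rwa [metricPosVec_eq_traceMetric (isUnit_of_mem_PosVec hτ)]
  exact eqOn_expLine_of_algAccel_eq_zero hJ hJ' (contDiffOn_infty.1 hγ.1 2)
    (fun t ht => isUnit_of_mem_PosVec (hγ.2.1 ht))
    (fun t ht => algAccel_eq_zero_of_isGeodesicOn coordSum_mul_comm
      (fun _ => isUnit_of_mem_PosVec) hdef (isGeodesicOn_metricPosVec_iff.1 hγ) ht (mem_univ _)) h₀

theorem sqSpeed_metricPosVec_eqOn (hγ : MapsTo γ (Icc 0 1) (PosVec n)) :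
    EqOn (sqSpeed metricPosVec γ) (sqSpeed (traceMetric (coordSum n)) γ) (Icc 0 1) :=
  fun t ht => by
    rw [sqSpeed, sqSpeed, metricPosVec_eq_traceMetric (isUnit_of_mem_PosVec (hγ ht))]

theorem continuousOn_sqSpeed_metricPosVec (hγ : ContDiffOn ℝ 1 γ (Icc 0 1))
    (hγP : MapsTo γ (Icc 0 1) (PosVec n)) :
    ContinuousOn (sqSpeed metricPosVec γ) (Icc 0 1) :=
  (continuousOn_sqSpeed_traceMetric hγ fun _ ht => isUnit_of_mem_PosVec (hγP ht)).congr
    (sqSpeed_metricPosVec_eqOn hγP)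

/-- The entrywise logarithm `log (τ₀⁻¹ ⊙ τ₁)`, whose Euclidean norm is the distance. -/
def relLog (τ₀ τ₁ : Fin n → ℝ) : EuclideanSpace ℝ (Fin n) :=
  WithLp.toLp 2 fun i => Real.log ((τ₀ i)⁻¹ * τ₁ i)

theorem hasDerivWithinAt_relLog (hτ : τ ∈ PosVec n) {γ' : Fin n → ℝ} {t : ℝ}
    (hγ : HasDerivWithinAt γ γ' J t) (ht : γ t ∈ PosVec n) :
    HasDerivWithinAt (fun r => relLog τ (γ r)) (WithLp.toLp 2 fun i => (γ t i)⁻¹ * γ' i) J t := by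
  refine ((PiLp.continuousLinearEquiv 2 ℝ fun _ : Fin n => ℝ).symm.hasFDerivAt
    |>.comp_hasDerivWithinAt t (hasDerivWithinAt_pi.2 fun i => ?_))
  have hi := (ht i).ne'
  have hτi := (hτ i).ne'
  convert! ((hasDerivWithinAt_pi.1 hγ i).const_mul (τ i)⁻¹).log (by positivity) using 1
  field_simp

theorem norm_relLog_le_curveLength (hγ : ContDiffOn ℝ 1 γ (Icc 0 1))
    (hγP : MapsTo γ (Icc 0 1) (PosVec n)) :
    ‖relLog (γ 0) (γ 1)‖ ≤ curveLength metricPosVec γ := by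
  have h₀ : γ 0 ∈ PosVec n := hγP (left_mem_Icc.2 zero_le_one)
  have hderiv : ∀ t ∈ Icc (0 : ℝ) 1, HasDerivWithinAt (fun r => relLog (γ 0) (γ r))
      (WithLp.toLp 2 fun i => (γ t i)⁻¹ * derivWithin γ (Icc 0 1) t i) (Icc 0 1) t := fun t ht =>
    hasDerivWithinAt_relLog h₀ (hγ.differentiableOn one_ne_zero t ht).hasDerivWithinAt (hγP ht)
  have hIoo : ∀ t ∈ Ioo (0 : ℝ) 1, HasDerivAt (fun r => relLog (γ 0) (γ r)) _ t := fun t ht =>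
    (hderiv t (Ioo_subset_Icc_self ht)).hasDerivAt (Icc_mem_nhds ht.1 ht.2)
  have hspeed : ∀ t, sqSpeed metricPosVec γ t =
      ‖WithLp.toLp 2 fun i => (γ t i)⁻¹ * derivWithin γ (Icc 0 1) t i‖ ^ 2 :=
    fun t => metricPosVec_self _ _
  have hself : relLog (γ 0) (γ 0) = 0 := by
    ext i
    simp [relLog, inv_mul_cancel₀ (h₀ i).ne']
  rw [← sub_zero (relLog _ _), ← hself, curveLength_eq_integral_sqrt_sqSpeed]
  refine norm_sub_le_integral_of_norm_deriv_le_of_le zero_le_one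
    (fun t ht => (hderiv t ht).continuousWithinAt)
    (fun t ht => (hIoo t ht).differentiableAt.differentiableWithinAt)
    (Filter.Eventually.of_forall fun t ht => ?_)
    ((continuousOn_sqSpeed_metricPosVec hγ hγP).sqrt.intervalIntegrable_of_Icc zero_le_one)
  rw [(hIoo t ht).deriv, hspeed, Real.sqrt_sq (norm_nonneg _)]

end PositiveVectors

section PositiveDefiniteMatrices

/-- The topology of the Frobenius norm, preferred from here on to the equal entrywise one, which
is found first but is not syntactically the topology of the norm. -/
local instance frobeniusTopology {m : Type*} [Fintype m] : TopologicalSpace (Matrix m m ℂ) :=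
  PseudoMetricSpace.toUniformSpace.toTopologicalSpace

local instance completeSpace_frobenius {m : Type*} [Fintype m] :
    @CompleteSpace (Matrix m m ℂ) PseudoMetricSpace.toUniformSpace :=
  FiniteDimensional.complete ℝ _

section Calculus

variable {m : Type*} [Fintype m] {γ : ℝ → Matrix m m ℂ} {J : Set ℝ} {t : ℝ}

theorem isHermitian_derivWithin (hγ : ∀ r ∈ J, (γ r).IsHermitian) (ht : t ∈ J) :
    (derivWithin γ J t).IsHermitian :=
  derivWithin.star.symm.trans (derivWithin_congr hγ (hγ t ht))

/-- The real part of the trace as a continuous linear functional. -/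
def reTrace (m : Type*) [Fintype m] : Matrix m m ℂ →L[ℝ] ℝ :=
  LinearMap.toContinuousLinearMap
    { toFun := fun M => M.trace.re
      map_add' := fun M N => by simp
      map_smul' := fun c M => by simp }

theorem reTrace_mul_comm (A B : Matrix m m ℂ) : reTrace m (A * B) = reTrace m (B * A) :=
  congrArg Complex.re (Matrix.trace_mul_comm A B)

variable [DecidableEq m]

theorem differentiable_det : Differentiable ℝ (Matrix.det : Matrix m m ℂ → ℂ) := by
  have hentry : ∀ i j, Differentiable ℝ (fun M : Matrix m m ℂ => M i j) := fun i j =>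
    (LinearMap.toContinuousLinearMap (Matrix.entryLinearMap ℝ ℂ i j)).differentiable
  rw [funext fun M : Matrix m m ℂ => Matrix.det_apply' M]
  exact Differentiable.fun_sum fun σ _ => Differentiable.const_mul
    (fun M => (HasFDerivAt.finsetProd fun i _ =>
      (hentry (σ i) i M).hasFDerivAt).differentiableAt) _

theorem hasDerivAt_det_one_add_smul (M : Matrix m m ℂ) :
    HasDerivAt (fun r : ℝ => (1 + r • M).det) M.trace 0 := by
  have heval : (fun r : ℝ => (1 + r • M).det) = fun r : ℝ =>
      (1 + (Polynomial.X : Polynomial ℂ) • M.map Polynomial.C).det.eval (r : ℂ) := by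
    funext r
    simp [eval_det, ← Matrix.smul_eq_mul_diagonal]
  have hderiv := (1 + (Polynomial.X : Polynomial ℂ) • M.map Polynomial.C).det.hasDerivAt
    ((0 : ℝ) : ℂ)
  rw [heval, ← Matrix.derivative_det_one_add_X_smul M]
  exact_mod_cast hderiv.comp_ofReal

theorem hasDerivWithinAt_det {V : Matrix m m ℂ} (hγ : HasDerivWithinAt γ V J t)
    (hu : IsUnit (γ t)) :
    HasDerivWithinAt (fun r => (γ r).det) ((γ t).det * ((γ t)⁻¹ * V).trace) J t := by
  have hu' : IsUnit (γ t).det := (Matrix.isUnit_iff_isUnit_det _).1 hu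
  have hfactor : (fun r => (γ r).det) = fun r => (γ t).det * ((γ t)⁻¹ * γ r).det := funext fun r =>
    by rw [← Matrix.det_mul, Matrix.mul_nonsing_inv_cancel_left _ _ hu']
  have hdet : HasFDerivAt Matrix.det _ (1 : Matrix m m ℂ) := (differentiable_det 1).hasFDerivAt
  have hline := hdet.comp_hasDerivAt_of_eq (0 : ℝ)
    (((hasDerivAt_id (0 : ℝ)).smul_const ((γ t)⁻¹ * V)).const_add 1) (by simp)
  have htrace := hline.unique (hasDerivAt_det_one_add_smul ((γ t)⁻¹ * V))
  rw [one_smul] at htrace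
  rw [hfactor, ← htrace]
  exact (hdet.comp_hasDerivWithinAt_of_eq t (hγ.const_mul (γ t)⁻¹)
    (Matrix.nonsing_inv_mul _ hu').symm).const_mul _

end Calculus

variable {p : ℕ} {A B ξ X V : Matrix (Fin p) (Fin p) ℂ} {γ : ℝ → Matrix (Fin p) (Fin p) ℂ}
  {J : Set ℝ} {t : ℝ}

theorem metricHPD_eq_traceMetric :
    metricHPD (p := p) = traceMetric (reTrace (Fin p)) := by
  funext A ξ η
  rw [traceMetric, ← Matrix.nonsing_inv_eq_ringInverse]
  rfl

theorem metricHPD_whiten (hA : A.PosDef) (X V W : Matrix (Fin p) (Fin p) ℂ) :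
    metricHPD (whiten A X) (whiten A V) (whiten A W) = metricHPD X V W := by
  rw [metricHPD_eq_traceMetric]
  exact traceMetric_conj reTrace_mul_comm (isUnit_hpow hA _) (isUnit_hpow hA _) X V W

theorem metricHPD_self (hA : A.PosDef) (hξ : ξ.IsHermitian) :
    metricHPD A ξ ξ = ‖whiten A ξ‖ ^ 2 := by
  rw [← metricHPD_whiten hA, whiten_self hA, ← re_trace_mul_self (isHermitian_whiten hξ),
    metricHPD, inv_one, one_mul, mul_one]

theorem eq_zero_of_metricHPD_self_eq_zero (hA : A.PosDef) (hξ : ξ.IsHermitian)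
    (h : metricHPD A ξ ξ = 0) : ξ = 0 := by
  rw [metricHPD_self hA hξ, sq_eq_zero_iff, norm_eq_zero] at h
  rw [← hpow_half_mul_whiten_mul_hpow_half hA ξ, h, mul_zero, zero_mul]

theorem trace_inv_mul_derivWithin_eq_zero (hγ : DifferentiableWithinAt ℝ γ J t)
    (hγS : MapsTo γ J (SHPD p)) (hJ : UniqueDiffWithinAt ℝ J t) (ht : t ∈ J) :
    ((γ t)⁻¹ * derivWithin γ J t).trace = 0 := by
  have hdet := (hasDerivWithinAt_det hγ.hasDerivWithinAt (hγS ht).1.isUnit).derivWithin hJ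
  rw [(hγS ht).2, one_mul] at hdet
  rw [← hdet, derivWithin_congr (fun r hr => (hγS hr).2) (hγS ht).2, derivWithin_fun_const,
    Pi.zero_apply]

theorem derivWithin_mem_tangentSHPD (hγ : DifferentiableWithinAt ℝ γ J t)
    (hγS : MapsTo γ J (SHPD p)) (hJ : UniqueDiffWithinAt ℝ J t) (ht : t ∈ J) :
    derivWithin γ J t ∈ tangentSHPD (γ t) :=
  ⟨isHermitian_derivWithin (fun _ hr => (hγS hr).1.isHermitian) ht,
    trace_inv_mul_derivWithin_eq_zero hγ hγS hJ ht⟩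

theorem algAccel_mem_tangentSHPD (hγ : ContDiffOn ℝ 2 γ J) (hγS : MapsTo γ J (SHPD p))
    (hJ : UniqueDiffOn ℝ J) (ht : t ∈ J) : algAccel γ J t ∈ tangentSHPD (γ t) := by
  have hd : DifferentiableOn ℝ γ J := hγ.differentiableOn (by simp)
  have hd' : DifferentiableOn ℝ (derivWithin γ J) J :=
    (hγ.derivWithin (m := 1) hJ (by norm_num)).differentiableOn (by simp)
  have hγ' : ∀ r ∈ J, (derivWithin γ J r).IsHermitian := fun r hr =>
    (derivWithin_mem_tangentSHPD (hd r hr) hγS (hJ r hr) hr).1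
  have hacc : (algAccel γ J t).IsHermitian := by
    rw [algAccel, ← Matrix.nonsing_inv_eq_ringInverse]
    exact (isHermitian_derivWithin hγ' ht).sub
      (isHermitian_conj (hγ' t ht) (hγS ht).1.inv.isHermitian)
  have htrace := (reTrace (Fin p)).hasFDerivAt.comp_hasDerivWithinAt t
    (hasDerivWithinAt_inverse_mul_derivWithin (hd t ht) (hd' t ht) (hγS ht).1.isUnit)
  have hzero : ∀ r ∈ J, reTrace (Fin p) ((γ r)⁻¹ʳ * derivWithin γ J r) = 0 := fun r hr => by
    rw [← Matrix.nonsing_inv_eq_ringInverse]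
    exact congrArg Complex.re (trace_inv_mul_derivWithin_eq_zero (hd r hr) hγS (hJ r hr) hr)
  refine ⟨hacc, Complex.ext ?_ (im_trace_mul_eq_zero (hγS ht).1.inv.isHermitian hacc)⟩
  have hre := (hJ t ht).eq_deriv _ htrace
    ((hasDerivWithinAt_const t J 0).congr hzero (hzero t ht))
  rwa [← Matrix.nonsing_inv_eq_ringInverse] at hre

theorem expLine_mem_SHPD (hA : A ∈ SHPD p) (hξ : ξ ∈ tangentSHPD A) (t : ℝ) :
    expLine A ξ t ∈ SHPD p := by
  rw [expLine, ← Matrix.nonsing_inv_eq_ringInverse]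
  exact mul_exp_smul_inv_mul_mem_SHPD hA hξ t

theorem isGeodesicOn_expLine_metricHPD (hA : A ∈ SHPD p) (hξ : ξ ∈ tangentSHPD A)
    (hJ : UniqueDiffOn ℝ J) : IsGeodesicOn (SHPD p) tangentSHPD metricHPD (expLine A ξ) J := by
  rw [metricHPD_eq_traceMetric]
  exact isGeodesicOn_traceMetric_of_algAccel_eq_zero reTrace_mul_comm (fun _ hX => hX.1.isUnit)
    (contDiff_expLine A ξ).contDiffOn (fun t _ => expLine_mem_SHPD hA hξ t)
    fun _ => algAccel_expLine hA.1.isUnit ξ hJ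

theorem eqOn_expLine_of_isGeodesicOn_metricHPD (hJ : J.OrdConnected) (hJ' : J.Nontrivial)
    (hγ : IsGeodesicOn (SHPD p) tangentSHPD metricHPD γ J) (h₀ : 0 ∈ J) :
    EqOn γ (expLine (γ 0) (derivWithin γ J 0)) J := by
  have hJu := uniqueDiffOn_of_ordConnected hJ hJ'
  have hdef : ∀ A ∈ SHPD p, ∀ ξ ∈ tangentSHPD A,
      traceMetric (reTrace (Fin p)) A ξ ξ = 0 → ξ = 0 := fun A hA ξ hξ h =>
    eq_zero_of_metricHPD_self_eq_zero hA.1 hξ.1 (by rwa [metricHPD_eq_traceMetric])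
  have hγ₂ : ContDiffOn ℝ 2 γ J := contDiffOn_infty.1 hγ.1 2
  exact eqOn_expLine_of_algAccel_eq_zero hJ hJ' hγ₂ (fun t ht => (hγ.2.1 ht).1.isUnit)
    (fun t ht => algAccel_eq_zero_of_isGeodesicOn reTrace_mul_comm (fun _ hX => hX.1.isUnit) hdef
      (by rwa [← metricHPD_eq_traceMetric]) ht (algAccel_mem_tangentSHPD hγ₂ hγ.2.1 hJu ht)) h₀

theorem sq_le_exp_add_exp_neg_sub_two (x : ℝ) : x ^ 2 ≤ Real.exp x + Real.exp (-x) - 2 := by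
  have hsinh : |x / 2| ≤ |Real.sinh (x / 2)| := by
    rw [Real.abs_sinh]
    exact Real.self_le_sinh_iff.2 (abs_nonneg _)
  have hexp : Real.exp x + Real.exp (-x) - 2 = (2 * Real.sinh (x / 2)) ^ 2 := by
    obtain ⟨y, rfl⟩ : ∃ y, 2 * y = x := ⟨x / 2, by ring⟩
    rw [← Real.cosh_add_sinh, ← Real.cosh_sub_sinh, mul_div_cancel_left₀ y two_ne_zero,
      Real.cosh_two_mul, Real.cosh_sq]
    ring
  rw [hexp]
  nlinarith [sq_le_sq.2 hsinh]

theorem re_trace_hlog_mul_inv_mul (hX : X.PosDef) (V : Matrix (Fin p) (Fin p) ℂ) :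
    (hlog X * X⁻¹ * V).trace.re = (hlog X * whiten X V).trace.re := by
  have hcomm : hlog X * hpow X (-(1 / 2)) = hpow X (-(1 / 2)) * hlog X := by
    simp only [hlog, hpow, cfc_mul_cfc, mul_comm]
  rw [whiten, ← hpow_neg_half_mul_hpow_neg_half hX, ← mul_assoc (hlog X), ← mul_assoc (hlog X),
    Matrix.trace_mul_comm _ (hpow X _), ← mul_assoc, ← mul_assoc, ← hcomm]

theorem abs_sq_log_sub_sq_log_sub_le {a b : ℝ} (ha : 0 < a) (hb : 0 < b) :
    |Real.log b ^ 2 - Real.log a ^ 2 - 2 * (Real.log a * a⁻¹ * b - Real.log a)| ≤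
      (2 * |Real.log a| + 1) * (a⁻¹ * b + a * b⁻¹ - 2) := by
  obtain ⟨x, rfl⟩ : ∃ x, Real.exp x = a := ⟨_, Real.exp_log ha⟩
  obtain ⟨h, rfl⟩ : ∃ h, Real.exp (x + h) = b := ⟨Real.log b - x, by simp [Real.exp_log hb]⟩
  have hmul : (Real.exp x)⁻¹ * Real.exp (x + h) = Real.exp h := by
    rw [← Real.exp_neg, ← Real.exp_add, neg_add_cancel_left]
  have hmul' : Real.exp x * (Real.exp (x + h))⁻¹ = Real.exp (-h) := by
    rw [← Real.exp_neg, ← Real.exp_add, neg_add, add_neg_cancel_left]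
  rw [Real.log_exp, Real.log_exp, mul_assoc, hmul, hmul']
  have hsq : h ^ 2 ≤ Real.exp h + Real.exp (-h) - 2 := sq_le_exp_add_exp_neg_sub_two h
  have hrem : |2 * x * (Real.exp h - 1 - h)| ≤
      2 * |x| * (Real.exp h + Real.exp (-h) - 2) := by
    rw [abs_mul, abs_mul, abs_two,
      abs_of_nonneg (a := Real.exp h - 1 - h) (by linarith [Real.add_one_le_exp h])]
    exact mul_le_mul_of_nonneg_left (by linarith [Real.add_one_le_exp (-h)]) (by positivity)
  calc |(x + h) ^ 2 - x ^ 2 - 2 * (x * Real.exp h - x)|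
      = |h ^ 2 - 2 * x * (Real.exp h - 1 - h)| := by ring_nf
    _ ≤ |h ^ 2| + |2 * x * (Real.exp h - 1 - h)| := abs_sub _ _
    _ ≤ _ := by
      rw [abs_of_nonneg (sq_nonneg h)]
      linarith

theorem exists_weights_norm_hlog_sq_sub (hA : A.PosDef) (hB : B.PosDef) :
    ∃ w : Fin p → Fin p → ℝ, (∀ i j, 0 ≤ w i j) ∧
      ‖hlog B‖ ^ 2 - ‖hlog A‖ ^ 2 - 2 * (hlog A * A⁻¹ * (B - A)).trace.re =
        ∑ i, ∑ j, w i j * (Real.log (hB.1.eigenvalues j) ^ 2 - Real.log (hA.1.eigenvalues i) ^ 2 -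
          2 * (Real.log (hA.1.eigenvalues i) * (hA.1.eigenvalues i)⁻¹ * hB.1.eigenvalues j -
            Real.log (hA.1.eigenvalues i))) ∧
      (A⁻¹ * B).trace.re + (A * B⁻¹).trace.re - 2 * p =
        ∑ i, ∑ j, w i j * ((hA.1.eigenvalues i)⁻¹ * hB.1.eigenvalues j +
          hA.1.eigenvalues i * (hB.1.eigenvalues j)⁻¹ - 2) := by
  obtain ⟨w, hw, htrace⟩ := exists_weights_re_trace_cfc_mul_cfc hA.1 hB.1
  rw [← re_trace_mul_self (isHermitian_hlog A), ← re_trace_mul_self (isHermitian_hlog B), hlog,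
    hlog]
  have hnormB := htrace (fun _ => 1) (fun x => Real.log x ^ 2)
  have hnormA := htrace (fun x => Real.log x ^ 2) (fun _ => 1)
  have hlinear := htrace (fun x => Real.log x * x⁻¹) (fun x => x)
  have hconst := htrace Real.log (fun _ => 1)
  have hinvA := htrace (fun x => x⁻¹) (fun x => x)
  have hinvB := htrace (fun x => x) (fun x => x⁻¹)
  have htotal := htrace (fun _ => 1) (fun _ => 1)
  simp only [cfc_one_of_isHermitian hA.1, cfc_one_of_isHermitian hB.1, cfc_id_of_isHermitian hA.1,
    cfc_id_of_isHermitian hB.1, cfc_inv_of_posDef hA, cfc_inv_of_posDef hB, ← cfc_mul_cfc, sq,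
    mul_one, one_mul, Matrix.trace_one, Fintype.card_fin, Complex.natCast_re]
    at hnormA hnormB hlinear hconst hinvA hinvB htotal
  refine ⟨w, hw, ?_, ?_⟩
  · rw [mul_sub, mul_assoc _ _ A, Matrix.nonsing_inv_mul A ((Matrix.isUnit_iff_isUnit_det A).1
      hA.isUnit), mul_one, Matrix.trace_sub, Complex.sub_re, hlinear, hconst]
    simp only [sq, hnormA, hnormB, mul_sub, Finset.sum_sub_distrib, Finset.mul_sum,
      mul_left_comm _ (2 : ℝ)]
  · rw [hinvA, hinvB, htotal]
    simp only [mul_sub, mul_add, Finset.sum_sub_distrib, Finset.sum_add_distrib, Finset.sum_mul,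
      mul_comm (2 : ℝ)]

/- This spares differentiating the functional calculus: the right-hand side bounds the first-order
remainder of `‖hlog B‖ ^ 2` at `A` and, being differentiable in `B` with a zero at its minimum
`B = A`, is itself `o(B - A)`. -/
theorem exists_abs_norm_hlog_sq_sub_le (hA : A.PosDef) :
    ∃ C : ℝ, ∀ B : Matrix (Fin p) (Fin p) ℂ, B.PosDef →
      |‖hlog B‖ ^ 2 - ‖hlog A‖ ^ 2 - 2 * (hlog A * A⁻¹ * (B - A)).trace.re| ≤
        C * ((A⁻¹ * B).trace.re + (A * B⁻¹).trace.re - 2 * p) := by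
  refine ⟨∑ i, (2 * |Real.log (hA.1.eigenvalues i)| + 1), fun B hB => ?_⟩
  obtain ⟨w, hw, hleft, hright⟩ := exists_weights_norm_hlog_sq_sub hA hB
  rw [hleft, hright, Finset.mul_sum]
  refine (Finset.abs_sum_le_sum_abs _ _).trans (Finset.sum_le_sum fun i _ =>
    (Finset.abs_sum_le_sum_abs _ _).trans ?_)
  rw [Finset.mul_sum]
  refine Finset.sum_le_sum fun j _ => ?_
  rw [abs_mul, abs_of_nonneg (hw i j), mul_left_comm]
  have hscalar := abs_sq_log_sub_sq_log_sub_le (hA.eigenvalues_pos i) (hB.eigenvalues_pos j)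
  have herror : 0 ≤ (hA.1.eigenvalues i)⁻¹ * hB.1.eigenvalues j +
      hA.1.eigenvalues i * (hB.1.eigenvalues j)⁻¹ - 2 :=
    nonneg_of_mul_nonneg_right ((abs_nonneg _).trans hscalar) (by positivity)
  have hconst : 2 * |Real.log (hA.1.eigenvalues i)| + 1 ≤
      ∑ i, (2 * |Real.log (hA.1.eigenvalues i)| + 1) :=
    Finset.single_le_sum (f := fun i => 2 * |Real.log (hA.1.eigenvalues i)| + 1)
      (fun _ _ => by positivity) (Finset.mem_univ i)
  exact mul_le_mul_of_nonneg_left (hscalar.trans (mul_le_mul_of_nonneg_right hconst herror))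
    (hw i j)

theorem hasDerivWithinAt_of_abs_sub_le {f k : ℝ → ℝ} (hk : HasDerivWithinAt k 0 J t)
    (hkt : k t = 0) (hle : ∀ r ∈ J, |f r - f t| ≤ k r) : HasDerivWithinAt f 0 J t := by
  rw [hasDerivWithinAt_iff_isLittleO] at hk ⊢
  simp only [smul_zero, sub_zero, hkt] at hk ⊢
  refine (Asymptotics.IsBigO.of_bound 1 ?_).trans_isLittleO hk
  filter_upwards [self_mem_nhdsWithin] with r hr
  rw [one_mul, Real.norm_eq_abs]
  exact (hle r hr).trans (le_abs_self _)

theorem hasDerivWithinAt_re_trace_inv_mul_add (hγ : HasDerivWithinAt γ V J t)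
    (hu : IsUnit (γ t)) :
    HasDerivWithinAt (fun r => ((γ t)⁻¹ * γ r).trace.re + (γ t * (γ r)⁻¹).trace.re) 0 J t := by
  simp only [Matrix.nonsing_inv_eq_ringInverse]
  have hsum := ((reTrace (Fin p)).hasFDerivAt.comp_hasDerivWithinAt t
    (hγ.const_mul (γ t)⁻¹ʳ)).add ((reTrace (Fin p)).hasFDerivAt.comp_hasDerivWithinAt t
      ((hasDerivWithinAt_ringInverse hγ hu).const_mul (γ t)))
  have hcancel : (γ t * ((γ t)⁻¹ʳ * V * (γ t)⁻¹ʳ)).trace = ((γ t)⁻¹ʳ * V).trace := by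
    rw [← mul_assoc, ← mul_assoc, Ring.mul_inverse_cancel _ hu, one_mul, Matrix.trace_mul_comm]
  convert! hsum using 1
  simp [reTrace, hcancel]

theorem hasDerivWithinAt_norm_hlog_sq (hγ : HasDerivWithinAt γ V J t)
    (hγP : ∀ r ∈ J, (γ r).PosDef) (ht : t ∈ J) :
    HasDerivWithinAt (fun r => ‖hlog (γ r)‖ ^ 2) (2 * (hlog (γ t) * whiten (γ t) V).trace.re)
      J t := by
  obtain ⟨C, hC⟩ := exists_abs_norm_hlog_sq_sub_le (hγP t ht)
  have hu := (hγP t ht).isUnit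
  have hdet := (Matrix.isUnit_iff_isUnit_det _).1 hu
  have hlinear := ((reTrace (Fin p)).hasFDerivAt.comp_hasDerivWithinAt t
    ((hγ.sub_const (γ t)).const_mul (hlog (γ t) * (γ t)⁻¹))).const_mul 2
  have hbound := ((hasDerivWithinAt_re_trace_inv_mul_add hγ hu).sub_const (2 * p : ℝ)).const_mul C
  rw [mul_zero] at hbound
  have hrem : HasDerivWithinAt (fun r => ‖hlog (γ r)‖ ^ 2 -
      2 * (hlog (γ t) * (γ t)⁻¹ * (γ r - γ t)).trace.re) 0 J t := by
    refine hasDerivWithinAt_of_abs_sub_le hbound ?_ fun r hr => ?_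
    · rw [Matrix.nonsing_inv_mul _ hdet, Matrix.mul_nonsing_inv _ hdet, Matrix.trace_one,
        Fintype.card_fin, Complex.natCast_re]
      ring
    · simpa only [sub_self, mul_zero, Matrix.trace_zero, Complex.zero_re, sub_zero,
        sub_right_comm] using hC (γ r) (hγP r hr)
  rw [← re_trace_hlog_mul_inv_mul (hγP t ht)]
  convert! hrem.add hlinear using 1
  · funext r
    exact (sub_add_cancel _ _).symm
  · exact (zero_add _).symm

theorem hasDerivWithinAt_whiten (A : Matrix (Fin p) (Fin p) ℂ) (hγ : HasDerivWithinAt γ V J t) :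
    HasDerivWithinAt (fun r => whiten A (γ r)) (whiten A V) J t :=
  (hγ.const_mul _).mul_const _

theorem continuousOn_sqSpeed_metricHPD (hγ : ContDiffOn ℝ 1 γ (Icc 0 1))
    (hγP : ∀ t ∈ Icc (0 : ℝ) 1, (γ t).PosDef) :
    ContinuousOn (sqSpeed metricHPD γ) (Icc 0 1) := by
  rw [metricHPD_eq_traceMetric]
  exact continuousOn_sqSpeed_traceMetric hγ fun t ht => (hγP t ht).isUnit

theorem norm_hlog_le_curveLength (hγ : ContDiffOn ℝ 1 γ (Icc 0 1))
    (hγP : ∀ t ∈ Icc (0 : ℝ) 1, (γ t).PosDef) (h₀ : γ 0 = 1) :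
    ‖hlog (γ 1)‖ ≤ curveLength metricHPD γ := by
  have hgrowth : ∀ t ∈ Icc (0 : ℝ) 1,
      2 * (hlog (γ t) * whiten (γ t) (derivWithin γ (Icc 0 1) t)).trace.re ≤
        2 * ‖hlog (γ t)‖ * √(sqSpeed metricHPD γ t) := fun t ht => by
    have hγ' : (derivWithin γ (Icc 0 1) t).IsHermitian :=
      isHermitian_derivWithin (fun r hr => (hγP r hr).isHermitian) ht
    rw [sqSpeed, metricHPD_self (hγP t ht) hγ', Real.sqrt_sq (norm_nonneg _), mul_assoc]
    gcongr
    exact re_trace_mul_le_norm_mul_norm (isHermitian_hlog _) (isHermitian_whiten hγ')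
  have hbound := sub_le_integral_of_deriv_sq_le (u := fun t => ‖hlog (γ t)‖) zero_le_one
    (fun t _ => norm_nonneg _) (fun t _ => Real.sqrt_nonneg _)
    (fun t ht => hasDerivWithinAt_norm_hlog_sq
      (hγ.differentiableOn one_ne_zero t ht).hasDerivWithinAt hγP ht)
    (continuousOn_sqSpeed_metricHPD hγ hγP).sqrt hgrowth
  rwa [h₀, hlog_one, norm_zero, sub_zero, ← curveLength_eq_integral_sqrt_sqSpeed] at hbound

theorem sqSpeed_metricHPD_whiten (hA : A.PosDef) (hγ : DifferentiableWithinAt ℝ γ (Icc 0 1) t)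
    (ht : t ∈ Icc (0 : ℝ) 1) :
    sqSpeed metricHPD (fun r => whiten A (γ r)) t = sqSpeed metricHPD γ t := by
  rw [sqSpeed, (hasDerivWithinAt_whiten A hγ.hasDerivWithinAt).derivWithin
    (uniqueDiffOn_Icc zero_lt_one t ht), metricHPD_whiten hA, sqSpeed]

theorem contDiffOn_whiten (A : Matrix (Fin p) (Fin p) ℂ) (hγ : ContDiffOn ℝ 1 γ J) :
    ContDiffOn ℝ 1 (fun t => whiten A (γ t)) J :=
  (ContDiffOn.mul contDiffOn_const hγ).mul contDiffOn_const

theorem norm_hlog_whiten_le_curveLength (hγ : ContDiffOn ℝ 1 γ (Icc 0 1))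
    (hγP : ∀ t ∈ Icc (0 : ℝ) 1, (γ t).PosDef) :
    ‖hlog (whiten (γ 0) (γ 1))‖ ≤ curveLength metricHPD γ := by
  have h₀ : (γ 0).PosDef := hγP 0 (left_mem_Icc.2 zero_le_one)
  have hlength : curveLength metricHPD (fun t => whiten (γ 0) (γ t)) = curveLength metricHPD γ :=
    curveLength_congr fun t ht =>
      sqSpeed_metricHPD_whiten h₀ (hγ.differentiableOn one_ne_zero t ht) ht
  have hbound := norm_hlog_le_curveLength (contDiffOn_whiten (γ 0) hγ)
    (fun t ht => posDef_whiten h₀ (hγP t ht)) (whiten_self h₀)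
  rwa [hlength] at hbound

end PositiveDefiniteMatrices

section ParameterManifold

attribute [local instance] frobeniusTopology completeSpace_frobenius

variable {p n : ℕ} {θ θ₀ θ₁ ξ : Param p n} {γ : ℝ → Param p n} {J : Set ℝ}

theorem zero_mem_tangentSHPD (A : Matrix (Fin p) (Fin p) ℂ) : 0 ∈ tangentSHPD A :=
  ⟨Matrix.isHermitian_zero, by rw [mul_zero, Matrix.trace_zero]⟩

theorem isGeodesicOn_fisherMetric_iff (hp : 0 < p) (hn : 0 < n) (hJ : UniqueDiffOn ℝ J) :
    IsGeodesicOn (paramManifold p n) tangentParam fisherMetric γ J ↔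
      IsGeodesicOn (SHPD p) tangentSHPD metricHPD (fun t => (γ t).1) J ∧
      IsGeodesicOn (PosVec n) tangentPosVec metricPosVec (fun t => (γ t).2) J := by
  refine isGeodesicOn_prodMetric_iff (by positivity) (by positivity)
    (fun A _ => zero_mem_tangentSHPD A) (fun _ _ => mem_univ _)
    (fun A V => by simp [metricHPD]) (fun τ v => by simp [metricPosVec])
    (fun A hA V W U => ?_) (fun τ hτ v w u => ?_) hJ
  · rw [metricHPD_eq_traceMetric]
    exact (hasLineDerivAt_traceMetric hA.1.isUnit V W U).lineDifferentiableAt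
  · refine ((hasLineDerivAt_traceMetric (φ := coordSum n) (isUnit_of_mem_PosVec hτ) v w u)
      |>.lineDifferentiableAt).congr_of_eventuallyEq ?_
    filter_upwards [metricPosVec_eventuallyEq_traceMetric (isUnit_of_mem_PosVec hτ)] with y hy
    rw [hy]

theorem expCurve_eq_expLine (hθ : θ ∈ paramManifold p n) (ξ : Param p n) :
    expCurve θ ξ = fun t => (expLine θ.1 ξ.1 t, expLine θ.2 ξ.2 t) := by
  funext t
  refine Prod.ext ?_ (funext fun i => ?_)
  · rw [expCurve, expLine, ← Matrix.nonsing_inv_eq_ringInverse]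
    rfl
  · exact (expLine_apply (isUnit_of_mem_PosVec hθ.2) ξ.2 t i).symm

theorem expCurve_zero (θ ξ : Param p n) : expCurve θ ξ 0 = θ := by
  simp [expCurve]

theorem hasDerivAt_expCurve_zero (hθ : θ ∈ paramManifold p n) (ξ : Param p n) :
    HasDerivAt (expCurve θ ξ) ξ 0 := by
  rw [expCurve_eq_expLine hθ]
  exact (hasDerivAt_expLine_zero hθ.1.1.isUnit ξ.1).prodMk
    (hasDerivAt_expLine_zero (isUnit_of_mem_PosVec hθ.2) ξ.2)

theorem isGeodesicOn_expCurve (hp : 0 < p) (hn : 0 < n) (hθ : θ ∈ paramManifold p n)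
    (hξ : ξ ∈ tangentParam θ) (hJ : UniqueDiffOn ℝ J) :
    IsGeodesicOn (paramManifold p n) tangentParam fisherMetric (expCurve θ ξ) J := by
  rw [isGeodesicOn_fisherMetric_iff hp hn hJ, expCurve_eq_expLine hθ]
  exact ⟨isGeodesicOn_expLine_metricHPD hθ.1 hξ.1 hJ,
    isGeodesicOn_expLine_metricPosVec hθ.2 ξ.2 hJ⟩

theorem eqOn_expCurve_of_isGeodesicOn (hp : 0 < p) (hn : 0 < n) (hJ : J.OrdConnected)
    (hJ' : J.Nontrivial) (h₀ : 0 ∈ J)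
    (hγ : IsGeodesicOn (paramManifold p n) tangentParam fisherMetric γ J) :
    EqOn γ (expCurve (γ 0) (derivWithin γ J 0)) J := by
  have hJu := uniqueDiffOn_of_ordConnected hJ hJ'
  have hd : DifferentiableWithinAt ℝ γ J 0 := hγ.1.differentiableOn (by simp) 0 h₀
  obtain ⟨hγ₁, hγ₂⟩ := (isGeodesicOn_fisherMetric_iff hp hn hJu).1 hγ
  have heq₁ := eqOn_expLine_of_isGeodesicOn_metricHPD hJ hJ' hγ₁ h₀
  have heq₂ := eqOn_expLine_of_isGeodesicOn_metricPosVec hJ hJ' hγ₂ h₀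
  rw [derivWithin_fst hd (hJu 0 h₀)] at heq₁
  rw [derivWithin_snd hd (hJu 0 h₀)] at heq₂
  rw [expCurve_eq_expLine (hγ.2.1 h₀)]
  exact fun t ht => Prod.ext (heq₁ ht) (heq₂ ht)

theorem derivWithin_mem_tangentParam {t : ℝ} (hγ : DifferentiableWithinAt ℝ γ J t)
    (hJ : UniqueDiffWithinAt ℝ J t) (ht : t ∈ J) (hγS : MapsTo γ J (paramManifold p n)) :
    derivWithin γ J t ∈ tangentParam (γ t) := by
  have hfst := derivWithin_mem_tangentSHPD (γ := fun r => (γ r).1) hγ.fst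
    (fun r hr => (hγS hr).1) hJ ht
  rw [derivWithin_fst hγ hJ] at hfst
  exact ⟨hfst, mem_univ _⟩

/-- The Riemannian logarithm: the initial velocity of the geodesic from `θ₀` to `θ₁`. -/
def logParam (θ₀ θ₁ : Param p n) : Param p n :=
  (hpow θ₀.1 (1 / 2) * hlog (whiten θ₀.1 θ₁.1) * hpow θ₀.1 (1 / 2),
    fun i => θ₀.2 i * Real.log ((θ₀.2 i)⁻¹ * θ₁.2 i))

theorem whiten_logParam_fst (h₀ : θ₀.1.PosDef) :
    whiten θ₀.1 (logParam θ₀ θ₁).1 = hlog (whiten θ₀.1 θ₁.1) :=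
  whiten_hpow_half_mul_mul_hpow_half h₀ _

theorem isHermitian_logParam_fst (θ₀ θ₁ : Param p n) : (logParam θ₀ θ₁).1.IsHermitian :=
  isHermitian_conj (isHermitian_hpow _ _) (isHermitian_hlog _)

theorem logParam_mem_tangentParam (h₀ : θ₀ ∈ paramManifold p n) (h₁ : θ₁ ∈ paramManifold p n) :
    logParam θ₀ θ₁ ∈ tangentParam θ₀ := by
  refine ⟨⟨isHermitian_logParam_fst θ₀ θ₁, ?_⟩, mem_univ _⟩
  rw [← trace_whiten h₀.1.1, whiten_logParam_fst h₀.1.1]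
  exact trace_hlog (whiten_mem_SHPD h₀.1 h₁.1)

theorem joinCurve_eq_expCurve (h₀ : θ₀ ∈ paramManifold p n) (h₁ : θ₁ ∈ paramManifold p n) :
    joinCurve θ₀ θ₁ = expCurve θ₀ (logParam θ₀ θ₁) := by
  funext t
  refine Prod.ext ?_ (funext fun i => ?_)
  · rw [joinCurve, expCurve, mul_exp_smul_inv_mul_eq h₀.1.1, whiten_logParam_fst h₀.1.1,
      hpow_eq_exp_smul_hlog (posDef_whiten h₀.1.1 h₁.1.1)]
  · have hi := h₀.2 i
    simp only [joinCurve, expCurve, logParam]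
    rw [inv_mul_cancel_left₀ hi.ne', mul_comm t, ← Real.rpow_def_of_pos
      (mul_pos (inv_pos.2 hi) (h₁.2 i)), Real.mul_rpow (inv_nonneg.2 hi.le) (h₁.2 i).le,
      Real.inv_rpow hi.le, Real.rpow_sub hi, Real.rpow_one, ← mul_assoc, div_eq_mul_inv]

theorem joinCurve_zero (h₀ : θ₀ ∈ paramManifold p n) (h₁ : θ₁ ∈ paramManifold p n) :
    joinCurve θ₀ θ₁ 0 = θ₀ := by
  rw [joinCurve_eq_expCurve h₀ h₁, expCurve_zero]

theorem joinCurve_one (h₀ : θ₀.1.PosDef) (h₁ : θ₁.1.PosDef) : joinCurve θ₀ θ₁ 1 = θ₁ := by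
  rw [joinCurve, hpow_one (posDef_whiten h₀ h₁).isHermitian, hpow_half_mul_whiten_mul_hpow_half h₀]
  simp

theorem logParam_expCurve_one (hθ : θ ∈ paramManifold p n) (hξ : ξ.1.IsHermitian) :
    logParam θ (expCurve θ ξ 1) = ξ := by
  refine Prod.ext ?_ (funext fun i => ?_)
  · simp only [logParam, expCurve]
    rw [mul_exp_smul_inv_mul_eq hθ.1.1, whiten_hpow_half_mul_mul_hpow_half hθ.1.1, one_smul,
      hlog_exp (isHermitian_whiten hξ), hpow_half_mul_whiten_mul_hpow_half hθ.1.1]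
  · have hi := (hθ.2 i).ne'
    simp only [logParam, expCurve]
    rw [inv_mul_cancel_left₀ hi, Real.log_exp, one_mul, mul_inv_cancel_left₀ hi]

theorem eqOn_joinCurve_of_isGeodesicOn (hp : 0 < p) (hn : 0 < n) (hJ : J.OrdConnected)
    (h₀ : 0 ∈ J) (h₁ : 1 ∈ J)
    (hγ : IsGeodesicOn (paramManifold p n) tangentParam fisherMetric γ J) :
    EqOn γ (joinCurve (γ 0) (γ 1)) J := by
  have hJ' : J.Nontrivial := ⟨0, h₀, 1, h₁, zero_ne_one⟩
  have hexp := eqOn_expCurve_of_isGeodesicOn hp hn hJ hJ' h₀ hγ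
  have hvel : derivWithin γ J 0 ∈ tangentParam (γ 0) :=
    derivWithin_mem_tangentParam (hγ.1.differentiableOn (by simp) 0 h₀)
      (uniqueDiffOn_of_ordConnected hJ hJ' 0 h₀) h₀ hγ.2.1
  rwa [joinCurve_eq_expCurve (hγ.2.1 h₀) (hγ.2.1 h₁), hexp h₁,
    logParam_expCurve_one (hγ.2.1 h₀) hvel.1.1]

theorem fisherMetric_logParam (h₀ : θ₀ ∈ paramManifold p n) (θ₁ : Param p n) :
    fisherMetric θ₀ (logParam θ₀ θ₁) (logParam θ₀ θ₁) =
      (1 / (p : ℝ)) * ‖hlog (whiten θ₀.1 θ₁.1)‖ ^ 2 + (1 / (n : ℝ)) * ‖relLog θ₀.2 θ₁.2‖ ^ 2 := by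
  have hsnd : (fun i => (θ₀.2 i)⁻¹ * (logParam θ₀ θ₁).2 i) =
      fun i => Real.log ((θ₀.2 i)⁻¹ * θ₁.2 i) :=
    funext fun i => inv_mul_cancel_left₀ (h₀.2 i).ne' _
  rw [fisherMetric, metricHPD_self h₀.1.1 (isHermitian_logParam_fst θ₀ θ₁),
    whiten_logParam_fst h₀.1.1, metricPosVec_self, hsnd, relLog]

theorem curveLength_expCurve (hθ : θ ∈ paramManifold p n) (ξ : Param p n) :
    curveLength fisherMetric (expCurve θ ξ) = √(fisherMetric θ ξ ξ) := by
  rw [expCurve_eq_expLine hθ]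
  refine curveLength_eq_sqrt_of_sqSpeed_eq fun t ht => ?_
  have hd : DifferentiableWithinAt ℝ (fun t => (expLine θ.1 ξ.1 t, expLine θ.2 ξ.2 t))
      (Icc 0 1) t :=
    ((hasDerivAt_expLine θ.1 ξ.1 t).prodMk
      (hasDerivAt_expLine θ.2 ξ.2 t)).differentiableAt.differentiableWithinAt
  refine (sqSpeed_prodMetric (1 / p : ℝ) (1 / n) hd ht).trans ?_
  rw [sqSpeed_metricPosVec_eqOn (fun t _ => expLine_mem_PosVec hθ.2 ξ.2 t) ht,
    sqSpeed_traceMetric_expLine (isUnit_of_mem_PosVec hθ.2) ξ.2 ht,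
    ← metricPosVec_eq_traceMetric (isUnit_of_mem_PosVec hθ.2), metricHPD_eq_traceMetric,
    sqSpeed_traceMetric_expLine hθ.1.1.isUnit ξ.1 ht, ← metricHPD_eq_traceMetric, fisherMetric]

theorem sqrt_fisherMetric_logParam_le_curveLength (hγ : ContDiffOn ℝ 1 γ (Icc 0 1))
    (hγS : MapsTo γ (Icc 0 1) (paramManifold p n)) :
    √(fisherMetric (γ 0) (logParam (γ 0) (γ 1)) (logParam (γ 0) (γ 1))) ≤
      curveLength fisherMetric γ := by
  have hγ₁ : ∀ t ∈ Icc (0 : ℝ) 1, (γ t).1.PosDef := fun t ht => (hγS ht).1.1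
  have hγ₂ : MapsTo (fun t => (γ t).2) (Icc 0 1) (PosVec n) := fun t ht => (hγS ht).2
  have hle₁ := norm_hlog_whiten_le_curveLength hγ.fst hγ₁
  have hle₂ := norm_relLog_le_curveLength hγ.snd hγ₂
  rw [fisherMetric_logParam (hγS (left_mem_Icc.2 zero_le_one))]
  refine le_trans (Real.sqrt_le_sqrt ?_) (sqrt_le_curveLength_prodMetric (a := 1 / p) (b := 1 / n)
    (by positivity) (by positivity) (hγ.differentiableOn one_ne_zero)
    (continuousOn_sqSpeed_metricHPD hγ.fst hγ₁) (continuousOn_sqSpeed_metricPosVec hγ.snd hγ₂)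
    (fun t ht => ?_) fun t _ => ?_)
  · gcongr
  · rw [sqSpeed, metricHPD_self (hγ₁ t ht)
      (isHermitian_derivWithin (fun r hr => (hγ₁ r hr).isHermitian) ht)]
    exact sq_nonneg _
  · rw [sqSpeed, metricPosVec_self]
    exact sq_nonneg _

theorem isLeast_curveLengths_fisherMetric (hp : 0 < p) (hn : 0 < n) (h₀ : θ₀ ∈ paramManifold p n)
    (h₁ : θ₁ ∈ paramManifold p n) :
    IsLeast (curveLengths (paramManifold p n) fisherMetric θ₀ θ₁)
      √(fisherMetric θ₀ (logParam θ₀ θ₁) (logParam θ₀ θ₁)) := by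
  have hlog := logParam_mem_tangentParam h₀ h₁
  have hjoin := isGeodesicOn_expCurve hp hn h₀ hlog (uniqueDiffOn_Icc zero_lt_one)
  refine ⟨⟨_, contDiffOn_infty.1 hjoin.1 1, hjoin.2.1, expCurve_zero _ _, ?_,
    curveLength_expCurve h₀ _⟩, ?_⟩
  · rw [← joinCurve_eq_expCurve h₀ h₁, joinCurve_one h₀.1.1 h₁.1.1]
  · rintro _ ⟨γ, hγ, hγS, rfl, rfl, rfl⟩
    exact sqrt_fisherMetric_logParam_le_curveLength hγ hγS

theorem riemannianDist_fisherMetric_sq (hp : 0 < p) (hn : 0 < n) (h₀ : θ₀ ∈ paramManifold p n)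
    (h₁ : θ₁ ∈ paramManifold p n) :
    riemannianDist (paramManifold p n) fisherMetric θ₀ θ₁ ^ 2 =
      (1 / (p : ℝ)) * ‖hlog (whiten θ₀.1 θ₁.1)‖ ^ 2 + (1 / (n : ℝ)) * ‖relLog θ₀.2 θ₁.2‖ ^ 2 := by
  rw [riemannianDist, (isLeast_curveLengths_fisherMetric hp hn h₀ h₁).csInf_eq,
    fisherMetric_logParam h₀, Real.sq_sqrt (by positivity)]

end ParameterManifold

end CompoundGaussian
end

theorem proposition2 (p n : ℕ) (hp : 0 < p) (hn : 0 < n) :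
    -- geodesics are exactly the pairs of geodesics of the two factors
    (∀ (γ : ℝ → Param p n) (J : Set ℝ), J.OrdConnected → J.Nontrivial →
      (IsGeodesicOn (paramManifold p n) tangentParam fisherMetric γ J ↔
        IsGeodesicOn (SHPD p) tangentSHPD metricHPD (fun t => (γ t).1) J ∧
        IsGeodesicOn (PosVec n) tangentPosVec metricPosVec (fun t => (γ t).2) J)) ∧
    -- the geodesic with given initial point and velocity
    (∀ θ ∈ paramManifold p n, ∀ ξ ∈ tangentParam θ,
      IsGeodesicOn (paramManifold p n) tangentParam fisherMetric (expCurve θ ξ) univ ∧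
      expCurve θ ξ 0 = θ ∧ HasDerivAt (expCurve θ ξ) ξ 0 ∧
      ∀ (γ : ℝ → Param p n) (J : Set ℝ), J.OrdConnected → J.Nontrivial → 0 ∈ J →
        IsGeodesicOn (paramManifold p n) tangentParam fisherMetric γ J →
        γ 0 = θ → derivWithin γ J 0 = ξ → EqOn γ (expCurve θ ξ) J) ∧
    -- the geodesic between two given points
    (∀ θ₀ ∈ paramManifold p n, ∀ θ₁ ∈ paramManifold p n,
      IsGeodesicOn (paramManifold p n) tangentParam fisherMetric (joinCurve θ₀ θ₁) univ ∧
      joinCurve θ₀ θ₁ 0 = θ₀ ∧ joinCurve θ₀ θ₁ 1 = θ₁ ∧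
      ∀ (γ : ℝ → Param p n) (J : Set ℝ), J.OrdConnected → 0 ∈ J → 1 ∈ J →
        IsGeodesicOn (paramManifold p n) tangentParam fisherMetric γ J →
        γ 0 = θ₀ → γ 1 = θ₁ → EqOn γ (joinCurve θ₀ θ₁) J) ∧
    -- the Riemannian distance
    (∀ θ₀ ∈ paramManifold p n, ∀ θ₁ ∈ paramManifold p n,
      (curveLengths (paramManifold p n) fisherMetric θ₀ θ₁).Nonempty ∧
      riemannianDist (paramManifold p n) fisherMetric θ₀ θ₁ ^ 2 =
        (1 / (p : ℝ)) * ‖hlog (whiten θ₀.1 θ₁.1)‖ ^ 2 +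
        (1 / (n : ℝ)) *
          ‖WithLp.toLp 2 (fun i => Real.log ((θ₀.2 i)⁻¹ * θ₁.2 i))‖ ^ 2) := by
  refine ⟨fun γ J hJ hJ' =>
      isGeodesicOn_fisherMetric_iff hp hn (uniqueDiffOn_of_ordConnected hJ hJ'),
    fun θ hθ ξ hξ => ⟨isGeodesicOn_expCurve hp hn hθ hξ uniqueDiffOn_univ, expCurve_zero θ ξ,
      hasDerivAt_expCurve_zero hθ ξ, ?_⟩,
    fun θ₀ h₀ θ₁ h₁ => ⟨?_, joinCurve_zero h₀ h₁, joinCurve_one h₀.1.1 h₁.1.1, ?_⟩,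
    fun θ₀ h₀ θ₁ h₁ => ⟨(isLeast_curveLengths_fisherMetric hp hn h₀ h₁).nonempty,
      riemannianDist_fisherMetric_sq hp hn h₀ h₁⟩⟩
  · rintro γ J hJ hJ' h0 hγ rfl rfl
    exact eqOn_expCurve_of_isGeodesicOn hp hn hJ hJ' h0 hγ
  · rw [joinCurve_eq_expCurve h₀ h₁]
    exact isGeodesicOn_expCurve hp hn h₀ (logParam_mem_tangentParam h₀ h₁) uniqueDiffOn_univ
  · rintro γ J hJ h0 h1 hγ rfl rfl
    exact eqOn_joinCurve_of_isGeodesicOn hp hn hJ h0 h1 hγ
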